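/- Let $d\ge 2$ be an integer, $0<s<1$, $p>1$, $q\ge 1$, $\tau\ge 1$, $0<a\le 1$, $\alpha,\beta,\gamma\in\mathbb{R}$, $\mu>1$ and $\Lambda>1$, with $\tau\le\mu$. Define $\sigma\in\mathbb{R}$ by $\gamma=a\sigma+(1-a)\beta$, and assume $$\frac1\tau+\frac\gamma d=a\Big(\frac1p+\frac{\alpha-s}{d}\Big)+(1-a)\Big(\frac1q+\frac\beta d\Big)\qquad\text{and}\qquad -(d-1)s\le\alpha-\sigma<0 .$$ For a measurable function $u$ on $\mathbb{R}^d$ set $$\|u\|_{\dot W^{s,p,\alpha,\Lambda}(\mathbb{R}^d)}=\Big(\int_{\mathbb{R}^d}\int_{\mathbb{R}^d}\frac{|u(x)-u(y)|^p\,|x|^{\alpha p}}{|x-y|^{d+sp}}\,\chi_\Lambda(|x|,|y|)\,dx\,dy\Big)^{1/p}\in[0,\infty],$$ where $\chi_\Lambda(r_1,r_2)=1$ if $\Lambda^{-1}r_1\le r_2\le\Lambda r_1$ and $\chi_\Lambda(r_1,r_2)=0$ otherwise. Let $B_R$ denote the open ball of radius $R$ centred at the origin. Then there exists a constant $C>0$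 such that for all radial (real-valued) $u\in L^1_{\rm loc}(\mathbb{R}^d\setminus\{0\})$ and all $R_1,R_2>0$ the following hold. i) If $\frac1\tau+\frac\gamma d=0$ and $\operatorname{supp}u\subset B_{R_2}$, then $$\Big(\int_{\mathbb{R}^d}\frac{|x|^{\gamma\tau}}{\ln^{\mu}(2R_2/|x|)}|u(x)|^\tau\,dx\Big)^{1/\tau}\le C\,\|u\|^{a}_{\dot W^{s,p,\alpha,\Lambda}(\mathbb{R}^d)}\,\big\||x|^\beta u\big\|^{1-a}_{L^q(\mathbb{R}^d)} .$$ ii) If $\frac1\tau+\frac\gamma d=0$ and $\operatorname{supp}u\cap B_{R_1}=\emptyset$, then $$\Big(\int_{\mathbb{R}^d}\frac{|x|^{\gamma\tau}}{\ln^{\mu}(2|x|/R_1)}|u(x)|^\tau\,dx\Big)^{1/\tau}\le C\,\|u\|^{a}_{\dot W^{s,p,\alpha,\Lambda}(\mathbb{R}^d)}\,\big\||x|^\beta u\big\|^{1-a}_{L^q(\mathbb{R}^d)} .$$ Here all quantities may be $+\infty$, with the conventions $(+\infty)\cdot 0=0\cdot(+\infty)=0$, $(+\infty)^0=1$ and $+\infty\le+\infty$;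 the integrands on the left are understood to be $0$ where $u=0$. -/

import Mathlib

noncomputable section

namespace RadialCKN

open MeasureTheory Topology

/-- The cut-off `χ_Λ(r₁, r₂)`: equal to `1` if `Λ⁻¹ r₁ ≤ r₂ ≤ Λ r₁` and to `0` otherwise. -/
def chi (Λ r₁ r₂ : ℝ) : ℝ :=
  open Classical in if Λ⁻¹ * r₁ ≤ r₂ ∧ r₂ ≤ Λ * r₁ then 1 else 0

/-- The weighted, truncated Gagliardo semi-norm of `u` on `ℝ^d`, with values in `[0, ∞]`:
`(∫∫ |u(x) - u(y)|^p |x|^(αp) |x - y|^(-(d+sp)) χ_Λ(|x|, |y|) dx dy)^(1/p)`. -/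
def gagliardo {d : ℕ} (s p α Λ : ℝ) (u : EuclideanSpace ℝ (Fin d) → ℝ) : ENNReal :=
  (∫⁻ y : EuclideanSpace ℝ (Fin d), ∫⁻ x : EuclideanSpace ℝ (Fin d),
    ENNReal.ofReal
      (|u x - u y| ^ p * ‖x‖ ^ (α * p) / ‖x - y‖ ^ ((d : ℝ) + s * p) * chi Λ ‖x‖ ‖y‖)) ^ (1 / p)

/-- The weighted norm `‖ |x|^β u ‖_{L^q(ℝ^d)}`, with values in `[0, ∞]`. -/
def weightedNorm {d : ℕ} (q β : ℝ) (u : EuclideanSpace ℝ (Fin d) → ℝ) : ENNReal :=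
  eLpNorm (fun x => ‖x‖ ^ β * u x) (ENNReal.ofReal q) volume

/-- `u` is radial, as an element of a space of functions modulo null sets: it agrees almost
everywhere with a function of `|x|`. -/
def IsRadial {d : ℕ} (u : EuclideanSpace ℝ (Fin d) → ℝ) : Prop :=
  ∃ f : ℝ → ℝ, ∀ᵐ x : EuclideanSpace ℝ (Fin d), u x = f ‖x‖

/-- The support of `u` as a function modulo null sets: the complement of the largest open set on
which `u` vanishes almost everywhere. -/
def essSupport {d : ℕ} (u : EuclideanSpace ℝ (Fin d) → ℝ) : Set (EuclideanSpace ℝ (Fin d)) :=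
  {x | ∀ U ∈ 𝓝 x, ¬ ∀ᵐ y : EuclideanSpace ℝ (Fin d), y ∈ U → u y = 0}

end RadialCKN

end

/-! For a radial function the problem is one-dimensional. With t = |y| and r comparable to t,
integrating |x - y|^(-(d+sp)) over the directions of x, |x| = r, leaves at least a multiple of
r^(-(d-1)) |r - t|^(-(1+sp)). Since |r - t| is at most a multiple of t, the order s can be lowered
to s' ≤ s at the price of a power of t. The choice s' = (s + σ - α)/d turns the balance condition
into the unweighted relation 1/τ = a(1/p - s') + (1-a)/q, and the bounds on α - σ give 0 < s' ≤ s.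

When 1/τ + γ/d = 0, the left side becomes a multiple of the integral of |g|^τ ln^(-μ) dr/r, so all
shells of a fixed ratio count equally. Take the ratio to be √Λ, so that two adjacent shells fit into
the window of χ_Λ. On such a double shell `interval_gagliardo_nirenberg` controls the oscillation of
the profile g. Hence the normalized L^τ norms on adjacent shells differ by at most C N_j^(a/p)
Q_j^((1-a)/q), where N_j and Q_j are the local parts of the two norms on the right.

Starting from a shell where u vanishes, telescoping and Hölder for sums bound the n-th norm by C E
n^(1-κ), where E is the global product and κ = a/p + (1-a)/q = 1/τ + a s'
(`exists_avgNorm_path_le`). The logarithm is at least a multiple of n on the n-th shell, so what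
remains is the sum of n^(-μ+(1-κ)τ). Its exponent is -μ + τ - 1 - a s' τ < -1, because τ ≤ μ and s'
> 0. `exists_radial_estimate` transfers the result to ℝ^d; case i) runs through the shells inwards,
case ii) outwards. -/

noncomputable section

namespace RadialCKN

open MeasureTheory Set Filter Metric
open scoped ENNReal Topology

/-! ### Fractional Gagliardo-Nirenberg inequality on an interval -/

/-- The inner integral of the one-dimensional Gagliardo seminorm over `I`. -/
def gagliardoDensity (s p : ℝ) (g : ℝ → ℝ) (I : Set ℝ) (x : ℝ) : ℝ≥0∞ :=
  ∫⁻ y in I, ENNReal.ofReal (|g x - g y| ^ p * |x - y| ^ (-(1 + s * p)))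

lemma measurable_gagliardoDensity (s p : ℝ) {g : ℝ → ℝ} (hg : Measurable g) (I : Set ℝ) :
    Measurable (gagliardoDensity s p g I) := by
  unfold gagliardoDensity
  apply Measurable.lintegral_prod_right'
    (f := fun z : ℝ × ℝ => ENNReal.ofReal (|g z.1 - g z.2| ^ p * |z.1 - z.2| ^ (-(1 + s * p))))
  fun_prop

lemma lintegral_le_Lp_mul_measure {X : Type*} [MeasurableSpace X] (ν : Measure X)
    {f : X → ℝ≥0∞} (hf : AEMeasurable f ν) {τ : ℝ} (hτ : 1 ≤ τ) :
    ∫⁻ x, f x ∂ν ≤ (∫⁻ x, f x ^ τ ∂ν) ^ (1 / τ) * ν univ ^ (1 - 1 / τ) := by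
  have h0 : 0 < τ := by linarith
  have h1 : 1 / τ ≤ 1 := by rw [div_le_one h0]; exact hτ
  have := ENNReal.lintegral_mul_norm_pow_le (μ := ν) (f := fun x => f x ^ τ) (g := fun _ => 1)
    (hf.pow_const τ) aemeasurable_const (p := 1 / τ) (q := 1 - 1 / τ) (by positivity)
    (by linarith) (by ring)
  simpa [← ENNReal.rpow_mul, mul_inv_cancel₀ h0.ne'] using this

/-- Hölder passes from L^1 to L^p, and |x - y| ≤ r allows the kernel |x - y|^(-(1+sp)) to be
inserted at the cost r^(1+sp). -/
lemma lintegral_enorm_sub_le {s p : ℝ} (hs : 0 < s) (hp : 1 ≤ p) {g : ℝ → ℝ} (hg : Measurable g)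
    {I J : Set ℝ} (hJ : MeasurableSet J) (hJI : J ⊆ I) {x r : ℝ} (hr : 0 < r)
    (hxJ : ∀ y ∈ J, |x - y| ≤ r) (hvol : volume J = ENNReal.ofReal r) :
    ∫⁻ y in J, ‖g x - g y‖ₑ
      ≤ ENNReal.ofReal r ^ (1 + s) * gagliardoDensity s p g I x ^ (1 / p) := by
  have hp0 : 0 < p := by linarith
  have hr0 : ENNReal.ofReal r ≠ 0 := by simpa using hr
  calc ∫⁻ y in J, ‖g x - g y‖ₑ
      ≤ (∫⁻ y in J, ‖g x - g y‖ₑ ^ p) ^ (1 / p) * volume.restrict J univ ^ (1 - 1 / p) :=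
        lintegral_le_Lp_mul_measure _ (by fun_prop) hp
    _ ≤ (ENNReal.ofReal (r ^ (1 + s * p)) * gagliardoDensity s p g I x) ^ (1 / p)
          * ENNReal.ofReal r ^ (1 - 1 / p) := by
        rw [Measure.restrict_apply_univ, hvol]
        gcongr
        rw [gagliardoDensity, ← lintegral_const_mul' _ _ ENNReal.ofReal_ne_top]
        refine (setLIntegral_mono' hJ fun y hy => ?_).trans (lintegral_mono_set hJI)
        rw [Real.enorm_eq_ofReal_abs, ENNReal.ofReal_rpow_of_nonneg (abs_nonneg _) hp0.le,
          ← ENNReal.ofReal_mul (by positivity)]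
        apply ENNReal.ofReal_le_ofReal
        rcases eq_or_ne x y with rfl | hxy
        · simp [Real.zero_rpow hp0.ne']
        have hxy' : 0 < |x - y| := abs_pos.2 (sub_ne_zero.2 hxy)
        have h1 : |x - y| ^ (1 + s * p) * |x - y| ^ (-(1 + s * p)) = 1 := by
          rw [← Real.rpow_add hxy']; simp
        have h2 : |x - y| ^ (1 + s * p) ≤ r ^ (1 + s * p) :=
          Real.rpow_le_rpow hxy'.le (hxJ y hy) (by positivity)
        have h3 : 0 ≤ |g x - g y| ^ p * |x - y| ^ (-(1 + s * p)) := by positivity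
        calc |g x - g y| ^ p
            = |x - y| ^ (1 + s * p) * (|g x - g y| ^ p * |x - y| ^ (-(1 + s * p))) := by
              rw [mul_left_comm, h1, mul_one]
          _ ≤ _ := by gcongr
    _ = _ := by
        rw [ENNReal.mul_rpow_of_nonneg _ _ (by positivity),
          ← ENNReal.ofReal_rpow_of_pos hr, ← ENNReal.rpow_mul, mul_right_comm,
          ← ENNReal.rpow_add _ _ hr0 ENNReal.ofReal_ne_top]
        congr 2
        field_simp
        ring

/-- Optimization in r: the two terms balance at r₀ = (G/φ)^(1/(s+1/τ)). If r₀ exceeds the admissible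
length ℓ, the bound `hℓ` without G is already good enough. -/
lemma le_two_mul_rpow_mul_rpow {s τ φ G ℓ v : ℝ} (hs : 0 < s) (hτ : 0 < τ) (hφ : 0 ≤ φ)
    (hG : 0 < G) (hℓ : v ≤ ℓ ^ s * φ) (hℓ0 : 0 < ℓ)
    (hr : ∀ r, 0 < r → r ≤ ℓ → v ≤ r ^ s * φ + r ^ (-(1 / τ)) * G) :
    v ≤ 2 * (φ ^ (1 / (1 + s * τ)) * G ^ (1 - 1 / (1 + s * τ))) := by
  have hsτ : 0 < 1 + s * τ := by positivity
  rcases hφ.eq_or_lt with rfl | hφ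
  · rw [Real.zero_rpow (by positivity)]; simpa using hℓ
  set r₀ := (G / φ) ^ (1 / (s + 1 / τ)) with hr₀
  have hst : 0 < s + 1 / τ := by positivity
  have hr₀0 : 0 < r₀ := by positivity
  have e1 : r₀ ^ s * φ = φ ^ (1 / (1 + s * τ)) * G ^ (1 - 1 / (1 + s * τ)) := by
    have h1 : 1 / (s + 1 / τ) * s = 1 - 1 / (1 + s * τ) := by field_simp; ring
    rw [hr₀, ← Real.rpow_mul (by positivity), Real.div_rpow hG.le hφ.le, div_mul_eq_mul_div,
      div_eq_iff (by positivity), mul_right_comm, ← Real.rpow_add hφ, h1, add_sub_cancel,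
      Real.rpow_one, mul_comm]
  have e2 : r₀ ^ (-(1 / τ)) * G = r₀ ^ s * φ := by
    have h : r₀ ^ (s + 1 / τ) = G / φ := by
      rw [hr₀, ← Real.rpow_mul (by positivity), one_div_mul_cancel hst.ne', Real.rpow_one]
    rw [Real.rpow_add hr₀0, eq_div_iff hφ.ne'] at h
    rw [Real.rpow_neg hr₀0.le, ← h]
    have : r₀ ^ (1 / τ) ≠ 0 := by positivity
    field_simp
  have hnn : 0 ≤ φ ^ (1 / (1 + s * τ)) * G ^ (1 - 1 / (1 + s * τ)) := by positivity
  rcases le_total r₀ ℓ with h | h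
  · have := hr r₀ hr₀0 h
    rw [e2, e1] at this
    linarith
  · have : ℓ ^ s * φ ≤ r₀ ^ s * φ := by gcongr
    rw [e1] at this
    linarith

/-- The difference g x - m is the mean of g x - g y over y, so the previous Hölder bound applies
with r the full length. -/
lemma enorm_sub_mean_le {s p : ℝ} (hs : 0 < s) (hp : 1 ≤ p) {g : ℝ → ℝ} (hg : Measurable g)
    {A B : ℝ} (hAB : A < B) (hgi : IntegrableOn g (Ico A B)) {x : ℝ} (hx : x ∈ Ico A B) :
    ‖g x - ⨍ y in Ico A B, g y‖ₑ
      ≤ ENNReal.ofReal (B - A) ^ s * gagliardoDensity s p g (Ico A B) x ^ (1 / p) := by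
  have hℓ : 0 < B - A := sub_pos.2 hAB
  have hℓ0 : ENNReal.ofReal (B - A) ≠ 0 := by simpa using hℓ
  have h1 : ENNReal.ofReal (B - A) * ‖g x - ⨍ y in Ico A B, g y‖ₑ
      ≤ ∫⁻ y in Ico A B, ‖g x - g y‖ₑ := by
    have e : (B - A) * (g x - ⨍ y in Ico A B, g y) = ∫ y in Ico A B, (g x - g y) := by
      rw [integral_sub (by simp) hgi, setAverage_eq]
      simp [hAB.le]
      field_simp
    rw [← Real.enorm_of_nonneg hℓ.le, ← enorm_mul, e]
    exact enorm_integral_le_lintegral_enorm _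
  have h2 := h1.trans (lintegral_enorm_sub_le hs hp hg measurableSet_Ico subset_rfl hℓ
    (x := x) (fun y hy => by
      rw [abs_le]; constructor <;> linarith [hx.1, hx.2, hy.1, hy.2]) (by simp))
  rw [ENNReal.rpow_add _ _ hℓ0 ENNReal.ofReal_ne_top, ENNReal.rpow_one, mul_assoc] at h2
  exact (ENNReal.mul_le_mul_iff_right hℓ0 ENNReal.ofReal_ne_top).1 h2

/-- Average |g x - m| ≤ |g x - g y| + |g y - m| over an interval of length r adherent to x. The
first part sees the Gagliardo density, the second the L^τ norm of g - m. -/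
lemma enorm_sub_const_le {s p τ : ℝ} (hs : 0 < s) (hp : 1 ≤ p) (hτ : 1 ≤ τ)
    {g : ℝ → ℝ} (hg : Measurable g) (m : ℝ) {A B r : ℝ} (hr : 0 < r) (hrB : r ≤ B - A)
    {x : ℝ} (hx : x ∈ Ico A B) :
    ‖g x - m‖ₑ ≤ ENNReal.ofReal r ^ s * gagliardoDensity s p g (Ico A B) x ^ (1 / p)
      + ENNReal.ofReal r ^ (-(1 / τ)) * (∫⁻ y in Ico A B, ‖g y - m‖ₑ ^ τ) ^ (1 / τ) := by
  have hr0 : ENNReal.ofReal r ≠ 0 := by simpa using hr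
  set c := max A (x - r) with hc
  have hcA : A ≤ c := le_max_left _ _
  have hcx : x - r ≤ c := le_max_right _ _
  have hcx' : c ≤ x := max_le hx.1 (by linarith)
  have hcB : c + r ≤ B := by
    rcases max_choice A (x - r) with h | h <;> rw [hc, h] <;> linarith [hx.2]
  set J := Ico c (c + r)
  have hJ : J ⊆ Ico A B := Ico_subset_Ico hcA hcB
  have hvol : volume J = ENNReal.ofReal r := by simp [J]
  have h1 : ENNReal.ofReal r * ‖g x - m‖ₑ
      ≤ ENNReal.ofReal r * (ENNReal.ofReal r ^ s * gagliardoDensity s p g (Ico A B) x ^ (1 / p)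
      + ENNReal.ofReal r ^ (-(1 / τ)) * (∫⁻ y in Ico A B, ‖g y - m‖ₑ ^ τ) ^ (1 / τ)) := by
    calc ENNReal.ofReal r * ‖g x - m‖ₑ = ∫⁻ y in J, ‖g x - m‖ₑ := by
          rw [setLIntegral_const, hvol, mul_comm]
      _ ≤ ∫⁻ y in J, (‖g x - g y‖ₑ + ‖g y - m‖ₑ) := by
          refine lintegral_mono fun y => ?_
          rw [← sub_add_sub_cancel (g x) (g y) m]
          exact enorm_add_le _ _
      _ = (∫⁻ y in J, ‖g x - g y‖ₑ) + ∫⁻ y in J, ‖g y - m‖ₑ :=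
          lintegral_add_left (by fun_prop) _
      _ ≤ ENNReal.ofReal r ^ (1 + s) * gagliardoDensity s p g (Ico A B) x ^ (1 / p)
          + (∫⁻ y in Ico A B, ‖g y - m‖ₑ ^ τ) ^ (1 / τ) * ENNReal.ofReal r ^ (1 - 1 / τ) := by
          gcongr
          · refine lintegral_enorm_sub_le hs hp hg measurableSet_Ico hJ hr (fun y hy => ?_) hvol
            rw [abs_le]; constructor <;> linarith [hy.1, hy.2]
          · refine (lintegral_le_Lp_mul_measure _ (by fun_prop) hτ).trans ?_
            rw [Measure.restrict_apply_univ, hvol]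
            gcongr
      _ = _ := by
          rw [ENNReal.rpow_add _ _ hr0 ENNReal.ofReal_ne_top, ENNReal.rpow_one, sub_eq_add_neg,
            ENNReal.rpow_add _ _ hr0 ENNReal.ofReal_ne_top, ENNReal.rpow_one]
          ring
  exact (ENNReal.mul_le_mul_iff_right hr0 ENNReal.ofReal_ne_top).1 h1

/-- Pointwise interpolation: optimizing the two preceding bounds over r gives powers θ = 1/(1+sτ) of
the density term and 1 - θ of the global norm G. -/
lemma enorm_sub_mean_le_rpow_mul_rpow {s p τ : ℝ} (hs : 0 < s) (hp : 1 ≤ p) (hτ : 1 ≤ τ)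
    {g : ℝ → ℝ} (hg : Measurable g) {A B m : ℝ} (hAB : A < B) (hgi : IntegrableOn g (Ico A B))
    (hm : m = ⨍ y in Ico A B, g y) {G : ℝ≥0∞}
    (hG : G = (∫⁻ y in Ico A B, ‖g y - m‖ₑ ^ τ) ^ (1 / τ)) (hG0 : G ≠ 0) (hGt : G ≠ ∞)
    {x : ℝ} (hx : x ∈ Ico A B) :
    ‖g x - m‖ₑ ≤ 2 * (gagliardoDensity s p g (Ico A B) x ^ (1 / p * (1 / (1 + s * τ)))
      * G ^ (1 - 1 / (1 + s * τ))) := by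
  have hsτ : 0 < s * τ := by positivity
  have hp0 : 0 < p := by linarith
  have hℓ : 0 < B - A := sub_pos.2 hAB
  have hθ : 0 < 1 / (1 + s * τ) := by positivity
  have hθ1 : 0 ≤ 1 - 1 / (1 + s * τ) := by
    rw [sub_nonneg, div_le_one (by positivity)]; linarith
  have h1 := enorm_sub_mean_le hs hp hg hAB hgi hx
  have h2 := fun r hr hrB => enorm_sub_const_le hs hp hτ hg m (r := r) hr hrB hx
  rw [← hm] at h1
  rw [← hG] at h2
  rw [ENNReal.rpow_mul]
  generalize gagliardoDensity s p g (Ico A B) x ^ (1 / p) = φ at h1 h2 ⊢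
  by_cases hφ : φ = ∞
  · rw [hφ, ENNReal.top_rpow_of_pos hθ, ENNReal.top_mul, ENNReal.mul_top (by simp)]
    · exact le_top
    · exact (ENNReal.rpow_pos (pos_iff_ne_zero.2 hG0) hGt).ne'
  lift φ to NNReal using hφ
  lift G to NNReal using hGt
  have hG0' : 0 < (G : ℝ) := by
    have : G ≠ 0 := by simpa using hG0
    positivity
  have key := le_two_mul_rpow_mul_rpow (s := s) (τ := τ) (φ := φ) (G := G) (ℓ := B - A)
    (v := ‖g x - m‖) hs (by linarith) φ.2 hG0' ?_ hℓ ?_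
  · rw [← ofReal_norm]
    refine (ENNReal.ofReal_le_ofReal key).trans_eq ?_
    rw [ENNReal.ofReal_mul (by simp), ENNReal.ofReal_mul (by positivity),
      ← ENNReal.ofReal_rpow_of_nonneg φ.coe_nonneg hθ.le, ← ENNReal.ofReal_rpow_of_pos hG0']
    simp
  · rw [← ofReal_norm, ENNReal.ofReal_rpow_of_pos hℓ, ← ENNReal.ofReal_coe_nnreal,
      ← ENNReal.ofReal_mul (by positivity)] at h1
    exact (ENNReal.ofReal_le_ofReal_iff (by positivity)).1 h1
  · intro r hr hrB
    have h3 := h2 r hr hrB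
    rw [← ofReal_norm, ENNReal.ofReal_rpow_of_pos hr, ENNReal.ofReal_rpow_of_pos hr,
      ← ENNReal.ofReal_coe_nnreal, ← ENNReal.ofReal_coe_nnreal,
      ← ENNReal.ofReal_mul (by positivity), ← ENNReal.ofReal_mul (by positivity),
      ← ENNReal.ofReal_add (by positivity) (by positivity)] at h3
    exact (ENNReal.ofReal_le_ofReal_iff (by positivity)).1 h3

lemma Lp_sub_mean_le {q : ℝ} (hq : 1 ≤ q) {g : ℝ → ℝ} (hg : Measurable g) {A B : ℝ}
    (hAB : A < B) :
    (∫⁻ x in Ico A B, ‖g x - ⨍ y in Ico A B, g y‖ₑ ^ q) ^ (1 / q)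
      ≤ 2 * (∫⁻ x in Ico A B, ‖g x‖ₑ ^ q) ^ (1 / q) := by
  have hq0 : 0 < q := by linarith
  have hℓ : 0 < B - A := sub_pos.2 hAB
  have hℓ0 : ENNReal.ofReal (B - A) ≠ 0 := by simpa using hℓ
  set m := ⨍ y in Ico A B, g y with hm
  set Q := (∫⁻ x in Ico A B, ‖g x‖ₑ ^ q) ^ (1 / q)
  have h1 : ENNReal.ofReal (B - A) * ‖m‖ₑ ≤ Q * ENNReal.ofReal (B - A) ^ (1 - 1 / q) := by
    have e : (B - A) * m = ∫ y in Ico A B, g y := by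
      rw [hm, setAverage_eq]
      simp [hAB.le]
      field_simp
    rw [← Real.enorm_of_nonneg hℓ.le, ← enorm_mul, e, Real.enorm_of_nonneg hℓ.le]
    refine (enorm_integral_le_lintegral_enorm _).trans ?_
    simpa [Q] using lintegral_le_Lp_mul_measure (volume.restrict (Ico A B))
      (f := fun x => ‖g x‖ₑ) (by fun_prop) hq
  have h2 : ‖m‖ₑ * ENNReal.ofReal (B - A) ^ (1 / q) ≤ Q := by
    rw [sub_eq_add_neg 1, ENNReal.rpow_add _ _ hℓ0 ENNReal.ofReal_ne_top, ENNReal.rpow_one,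
      mul_left_comm, ENNReal.mul_le_mul_iff_right hℓ0 ENNReal.ofReal_ne_top,
      ENNReal.rpow_neg, ← div_eq_mul_inv, ENNReal.le_div_iff_mul_le] at h1
    · exact h1
    · exact Or.inl (ENNReal.rpow_pos (pos_iff_ne_zero.2 hℓ0) ENNReal.ofReal_ne_top).ne'
    · exact Or.inl (ENNReal.rpow_ne_top_of_nonneg (by positivity) ENNReal.ofReal_ne_top)
  calc (∫⁻ x in Ico A B, ‖g x - m‖ₑ ^ q) ^ (1 / q)
      ≤ (∫⁻ x in Ico A B, ((fun x => ‖g x‖ₑ) + (fun _ => ‖m‖ₑ) : ℝ → ℝ≥0∞) x ^ q) ^ (1 / q) := by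
        gcongr with x
        exact enorm_sub_le
    _ ≤ Q + (∫⁻ x in Ico A B, ‖m‖ₑ ^ q) ^ (1 / q) :=
        ENNReal.lintegral_Lp_add_le (by fun_prop) (by fun_prop) hq
    _ ≤ Q + Q := by
        gcongr
        rw [setLIntegral_const, ENNReal.mul_rpow_of_nonneg _ _ (by positivity), ← ENNReal.rpow_mul,
          mul_one_div_cancel hq0.ne', ENNReal.rpow_one]
        simpa using h2
    _ = 2 * Q := (two_mul Q).symm

/-- A scale-invariant fractional Gagliardo-Nirenberg inequality on an interval. -/
lemma interval_gagliardo_nirenberg {s p q τ a : ℝ} (hs : 0 < s) (hp : 1 ≤ p) (hq : 1 ≤ q)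
    (hτ : 1 ≤ τ) (ha0 : 0 < a) (ha1 : a ≤ 1) (hbal : 1 / τ = a * (1 / p - s) + (1 - a) * (1 / q))
    {g : ℝ → ℝ} (hg : Measurable g) {M : ℝ} (hM : ∀ x, |g x| ≤ M) {A B : ℝ} (hAB : A < B) :
    ∃ m : ℝ, (∫⁻ x in Ico A B, ‖g x - m‖ₑ ^ τ) ^ (1 / τ) ≤
      2 ^ (a * (1 + s * τ) + (1 - a)) * ((∫⁻ x in Ico A B, gagliardoDensity s p g (Ico A B) x) ^ (a / p)
        * (∫⁻ x in Ico A B, ‖g x‖ₑ ^ q) ^ ((1 - a) / q)) := by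
  have hp0 : 0 < p := by linarith
  have hq0 : 0 < q := by linarith
  have hτ0 : 0 < τ := by linarith
  set I := Ico A B with hI
  have hgi : IntegrableOn g I := by
    refine Measure.integrableOn_of_bounded (M := M) (by simp [hI]) hg.aestronglyMeasurable ?_
    exact ae_of_all _ hM
  set m := ⨍ y in I, g y with hm
  refine ⟨m, ?_⟩
  set G := (∫⁻ x in I, ‖g x - m‖ₑ ^ τ) ^ (1 / τ) with hG
  by_cases hG0 : G = 0
  · rw [hG0]; exact zero_le
  -- Boundedness of g is needed here: a power of G is divided out below.
  have hGt : G ≠ ∞ := by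
    refine ENNReal.rpow_ne_top_of_nonneg (by positivity) (ne_of_lt ?_)
    calc ∫⁻ x in I, ‖g x - m‖ₑ ^ τ ≤ ∫⁻ x in I, ENNReal.ofReal (M + |m|) ^ τ := by
          gcongr with x
          rw [Real.enorm_eq_ofReal_abs]
          exact ENNReal.ofReal_le_ofReal ((abs_sub _ _).trans (by linarith [hM x]))
      _ < ∞ := by
          rw [setLIntegral_const]
          exact ENNReal.mul_lt_top (ENNReal.rpow_lt_top_of_nonneg hτ0.le ENNReal.ofReal_ne_top)
            (by simp [hI])
  set P := ∫⁻ x in I, gagliardoDensity s p g I x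
  set θ := 1 / (1 + s * τ) with hθ
  have hθ0 : 0 < θ := by positivity
  have hθ1 : θ ≤ 1 := by rw [hθ, div_le_one (by positivity)]; nlinarith
  -- The exponents X + Y = τ split |g - m|^τ so that the pointwise bound is applied to the factor of
  -- power X only. They are tuned so that the Hölder exponents of P and H add up to 1 (`hsum`).
  set D := a + θ * (1 - a) with hD
  have hD0 : 0 < D := by nlinarith
  set X := a * τ / D
  set Y := θ * (1 - a) * τ / D
  have hX : 0 ≤ X := by positivity
  have hY : 0 ≤ Y := by have : 0 ≤ 1 - a := by linarith
                        positivity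
  have hXY : X + Y = τ := by simp only [X, Y]; field_simp; ring
  have hsum : 1 / p * θ * X + Y / q = 1 := by
    have h1 : a / p + (1 - a) / q = 1 / τ + a * s := by rw [hbal]; ring
    have h2 : 1 / p * θ * X + Y / q = θ * τ * (a / p + (1 - a) / q) / D := by
      simp only [X, Y]; field_simp
    have h3 : θ * (1 + s * τ) = 1 := by rw [hθ]; field_simp
    rw [h2, h1, div_eq_one_iff_eq hD0.ne', hD]
    have h4 : θ * τ * (1 / τ + a * s) = θ + θ * s * τ * a := by field_simp
    rw [h4]
    linear_combination a * h3
  have hGτ : G ^ τ = ∫⁻ x in I, ‖g x - m‖ₑ ^ τ := by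
    rw [hG, ← ENNReal.rpow_mul, one_div_mul_cancel hτ0.ne', ENNReal.rpow_one]
  set H := ∫⁻ x in I, ‖g x - m‖ₑ ^ q with hH
  have key : G ^ τ ≤ 2 ^ X * G ^ ((1 - θ) * X) * (P ^ (1 / p * θ * X) * H ^ (Y / q)) := by
    have hc : (2 : ℝ≥0∞) ^ X * G ^ ((1 - θ) * X) ≠ ∞ := by
      refine ENNReal.mul_ne_top (ENNReal.rpow_ne_top_of_nonneg hX (by simp))
        (ENNReal.rpow_ne_top_of_nonneg (mul_nonneg (by linarith) hX) hGt)
    calc G ^ τ = ∫⁻ x in I, ‖g x - m‖ₑ ^ τ := hGτ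
      _ ≤ ∫⁻ x in I, 2 ^ X * G ^ ((1 - θ) * X) *
            (gagliardoDensity s p g I x ^ (1 / p * θ * X) * (‖g x - m‖ₑ ^ q) ^ (Y / q)) := by
          refine setLIntegral_mono' measurableSet_Ico fun x hx => ?_
          have h1 := enorm_sub_mean_le_rpow_mul_rpow hs hp hτ hg hAB hgi hm hG hG0 hGt hx
          have hqY : (‖g x - m‖ₑ ^ q) ^ (Y / q) = ‖g x - m‖ₑ ^ Y := by
            rw [← ENNReal.rpow_mul, mul_div_cancel₀ _ hq0.ne']
          rw [hqY]
          calc ‖g x - m‖ₑ ^ τ = ‖g x - m‖ₑ ^ X * ‖g x - m‖ₑ ^ Y := by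
                rw [← hXY, ENNReal.rpow_add_of_nonneg _ _ hX hY]
            _ ≤ (2 * (gagliardoDensity s p g I x ^ (1 / p * θ) * G ^ (1 - θ))) ^ X
                * ‖g x - m‖ₑ ^ Y := by gcongr
            _ = _ := by
                rw [ENNReal.mul_rpow_of_nonneg _ _ hX, ENNReal.mul_rpow_of_nonneg _ _ hX,
                  ← ENNReal.rpow_mul, ← ENNReal.rpow_mul]
                ring
      _ = 2 ^ X * G ^ ((1 - θ) * X) * ∫⁻ x in I,
            (gagliardoDensity s p g I x ^ (1 / p * θ * X) * (‖g x - m‖ₑ ^ q) ^ (Y / q)) :=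
          lintegral_const_mul' _ _ hc
      _ ≤ _ := by
          gcongr
          exact ENNReal.lintegral_mul_norm_pow_le
            (measurable_gagliardoDensity s p hg I).aemeasurable (by fun_prop)
            (by positivity) (by positivity) hsum
  -- K is the power of G left after absorbing G^((1-θ)X) into the left side; taking the 1/K-th power
  -- then yields the exponents a/p and (1-a)/q.
  set K := θ * τ / D
  have hK0 : 0 < K := by positivity
  have hK : K = τ - (1 - θ) * X := by
    simp only [K, X]; field_simp; rw [hD]; ring
  have key2 : G ^ K ≤ 2 ^ X * (P ^ (1 / p * θ * X) * H ^ (Y / q)) := by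
    have e : G ^ τ = G ^ ((1 - θ) * X) * G ^ K := by
      rw [← ENNReal.rpow_add _ _ hG0 hGt, hK]; congr 1; ring
    rw [e, mul_comm (2 ^ X), mul_assoc, ENNReal.mul_le_mul_iff_right] at key
    · exact key
    · exact (ENNReal.rpow_pos (pos_iff_ne_zero.2 hG0) hGt).ne'
    · exact ENNReal.rpow_ne_top_of_nonneg (mul_nonneg (by linarith) hX) hGt
  have key3 : G ≤ 2 ^ (a * (1 + s * τ)) * (P ^ (a / p) * H ^ ((1 - a) / q)) := by
    have h1 := ENNReal.rpow_le_rpow key2 (one_div_nonneg.2 hK0.le)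
    rw [← ENNReal.rpow_mul, mul_one_div_cancel hK0.ne', ENNReal.rpow_one,
      ENNReal.mul_rpow_of_nonneg _ _ (by positivity), ENNReal.mul_rpow_of_nonneg _ _ (by positivity),
      ← ENNReal.rpow_mul, ← ENNReal.rpow_mul, ← ENNReal.rpow_mul] at h1
    convert h1 using 3
    · simp only [X, K, hθ]; field_simp
    · congr 1; simp only [X, K]; field_simp
    · congr 1; simp only [Y, K]; field_simp
  have hHQ : H ^ ((1 - a) / q) ≤ 2 ^ (1 - a) * (∫⁻ x in I, ‖g x‖ₑ ^ q) ^ ((1 - a) / q) := by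
    have h1 := ENNReal.rpow_le_rpow (Lp_sub_mean_le hq hg hAB) (sub_nonneg.2 ha1)
    rw [ENNReal.mul_rpow_of_nonneg _ _ (sub_nonneg.2 ha1), ← ENNReal.rpow_mul, ← ENNReal.rpow_mul,
      one_div_mul_eq_div] at h1
    exact h1
  calc G ≤ 2 ^ (a * (1 + s * τ)) * (P ^ (a / p) * (2 ^ (1 - a) *
        (∫⁻ x in I, ‖g x‖ₑ ^ q) ^ ((1 - a) / q))) := key3.trans (by gcongr)
    _ = _ := by
        rw [ENNReal.rpow_add _ _ (by simp) (by simp)]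
        ring

/-! ### Normalized norms and scale-invariant estimates on double shells -/

/-- The `L^τ` norm of `f` over `[A, B)` with respect to the normalized Lebesgue measure. -/
def avgNorm (τ A B : ℝ) (f : ℝ → ℝ) : ℝ≥0∞ :=
  (∫⁻ x, ‖f x‖ₑ ^ τ ∂((ENNReal.ofReal (B - A))⁻¹ • volume.restrict (Ico A B))) ^ (1 / τ)

lemma avgNorm_const {τ A B : ℝ} (hτ : 0 < τ) (hAB : A < B) (m : ℝ) :
    avgNorm τ A B (fun _ => m) = ‖m‖ₑ := by
  have hℓ : ENNReal.ofReal (B - A) ≠ 0 := by simpa using hAB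
  rw [avgNorm, lintegral_const, Measure.smul_apply, Measure.restrict_apply_univ, Real.volume_Ico,
    smul_eq_mul, ENNReal.inv_mul_cancel hℓ ENNReal.ofReal_ne_top, mul_one, ← ENNReal.rpow_mul,
    mul_one_div_cancel hτ.ne', ENNReal.rpow_one]

lemma avgNorm_le_add {τ A B : ℝ} (hτ : 1 ≤ τ) {f g h : ℝ → ℝ} (hg : Measurable g)
    (hh : Measurable h) (hf : ∀ x, ‖f x‖ₑ ≤ ‖g x‖ₑ + ‖h x‖ₑ) :
    avgNorm τ A B f ≤ avgNorm τ A B g + avgNorm τ A B h := by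
  have hτ0 : 0 ≤ τ := by linarith
  refine le_trans ?_ (ENNReal.lintegral_Lp_add_le (f := fun x => ‖g x‖ₑ) (g := fun x => ‖h x‖ₑ)
    (by fun_prop) (by fun_prop) hτ)
  rw [avgNorm]
  gcongr with x
  exact hf x

/-- Normalization gives a constant m the same norm on both intervals, so the two norms of g are
compared through m. -/
lemma avgNorm_le_avgNorm_add {τ A B A' B' : ℝ} (hτ : 1 ≤ τ) (hAB : A < B) (hAB' : A' < B')
    {g : ℝ → ℝ} (hg : Measurable g) (m : ℝ) :
    avgNorm τ A B g ≤ avgNorm τ A' B' g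
      + (avgNorm τ A B (fun x => g x - m) + avgNorm τ A' B' (fun x => g x - m)) := by
  have hτ0 : 0 < τ := by linarith
  have h1 : avgNorm τ A B g ≤ avgNorm τ A B (fun x => g x - m) + avgNorm τ A B (fun _ => m) :=
    avgNorm_le_add hτ (by fun_prop) (by fun_prop) fun x => by
      simpa using enorm_add_le (g x - m) m
  have h2 : avgNorm τ A' B' (fun _ => m)
      ≤ avgNorm τ A' B' g + avgNorm τ A' B' (fun x => g x - m) :=
    avgNorm_le_add hτ (by fun_prop) (by fun_prop) fun x => by
      simpa using enorm_sub_le (a := g x) (b := g x - m)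
  rw [avgNorm_const hτ0 hAB] at h1
  rw [avgNorm_const hτ0 hAB'] at h2
  calc _ ≤ _ := h1
    _ ≤ avgNorm τ A B (fun x => g x - m)
        + (avgNorm τ A' B' g + avgNorm τ A' B' (fun x => g x - m)) := by gcongr
    _ = _ := by ring

lemma avgNorm_le_of_subset {τ A B δ : ℝ} (hτ : 0 < τ) (hδB : δ ≤ B - A) {I : Set ℝ}
    (hI : Ico A B ⊆ I) (f : ℝ → ℝ) :
    avgNorm τ A B f ≤ ENNReal.ofReal δ ^ (-(1 / τ)) * (∫⁻ x in I, ‖f x‖ₑ ^ τ) ^ (1 / τ) := by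
  rw [avgNorm, lintegral_smul_measure, smul_eq_mul,
    ENNReal.mul_rpow_of_nonneg _ _ (by positivity), ENNReal.inv_rpow, ENNReal.rpow_neg]
  gcongr

/-- The part of the reduced Gagliardo seminorm at radius `t`. -/
def radialDensity (s p w Λ : ℝ) (g : ℝ → ℝ) (t : ℝ) : ℝ≥0∞ :=
  gagliardoDensity s p g (Icc (Λ⁻¹ * t) (Λ * t)) t * ENNReal.ofReal (t ^ w)

lemma rpow_neg_le_of_mem {T Λ t w : ℝ} (hT : 0 < T) (hΛ : 1 < Λ) (ht : T ≤ t) (ht' : t ≤ Λ * T) :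
    t ^ (-w) ≤ Λ ^ |w| * T ^ (-w) := by
  have ht0 : 0 < t := hT.trans_le ht
  have h1 : 1 ≤ Λ ^ |w| := Real.one_le_rpow hΛ.le (abs_nonneg _)
  rcases le_total 0 w with hw | hw
  · calc t ^ (-w) ≤ T ^ (-w) := Real.rpow_le_rpow_of_nonpos hT ht (by linarith)
      _ ≤ _ := le_mul_of_one_le_left (by positivity) h1
  · calc t ^ (-w) ≤ (Λ * T) ^ (-w) := Real.rpow_le_rpow ht0.le ht' (by linarith)
      _ = Λ ^ |w| * T ^ (-w) := by rw [Real.mul_rpow (by linarith) hT.le, abs_of_nonpos hw]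

lemma setLIntegral_le_weighted {T Λ : ℝ} (w : ℝ) (hT : 0 < T) (hΛ : 1 < Λ) (f : ℝ → ℝ≥0∞) :
    ∫⁻ t in Ico T (Λ * T), f t
      ≤ ENNReal.ofReal (Λ ^ |w|) * ENNReal.ofReal T ^ (-w)
        * ∫⁻ t in Ico T (Λ * T), f t * ENNReal.ofReal (t ^ w) := by
  rw [ENNReal.ofReal_rpow_of_pos hT, ← ENNReal.ofReal_mul (by positivity),
    ← lintegral_const_mul' _ _ ENNReal.ofReal_ne_top]
  refine setLIntegral_mono' measurableSet_Ico fun t ht => ?_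
  have ht0 : 0 < t := hT.trans_le ht.1
  rw [mul_left_comm, ← ENNReal.ofReal_mul (by positivity)]
  refine le_mul_of_one_le_right' ?_
  rw [← ENNReal.ofReal_one]
  apply ENNReal.ofReal_le_ofReal
  calc (1 : ℝ) = t ^ (-w) * t ^ w := by rw [← Real.rpow_add ht0]; simp
    _ ≤ _ := by
      gcongr
      exact rpow_neg_le_of_mem hT hΛ ht.1 ht.2.le

/-- The interval inequality is applied on the whole double shell, so one constant m serves both
halves. The weights are comparable to powers of T there, and `hscale` says exactly that all powers
of T cancel. -/
lemma exists_shell_estimate {s p q τ a w v lam : ℝ} (hs : 0 < s) (hp : 1 ≤ p) (hq : 1 ≤ q)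
    (hτ : 1 ≤ τ) (ha0 : 0 < a) (ha1 : a ≤ 1) (hbal : 1 / τ = a * (1 / p - s) + (1 - a) * (1 / q))
    (hscale : 1 / τ + w * (a / p) + v * ((1 - a) / q) = 0) (hlam : 1 < lam) :
    ∃ C : ℝ≥0∞, C ≠ ∞ ∧ ∀ g : ℝ → ℝ, Measurable g → (∃ M, ∀ x, |g x| ≤ M) → ∀ T, 0 < T →
      ∃ m : ℝ, avgNorm τ T (lam * T) (fun x => g x - m)
          + avgNorm τ (lam * T) (lam ^ 2 * T) (fun x => g x - m)
        ≤ C * ((∫⁻ t in Ico T (lam ^ 2 * T), radialDensity s p w (lam ^ 2) g t) ^ (a / p)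
          * (∫⁻ t in Ico T (lam ^ 2 * T), ‖g t‖ₑ ^ q * ENNReal.ofReal (t ^ v)) ^ ((1 - a) / q)) := by
  have hp0 : 0 < p := by linarith
  have hq0 : 0 < q := by linarith
  have hτ0 : 0 < τ := by linarith
  have hΛ : 1 < lam ^ 2 := one_lt_pow₀ hlam (by norm_num)
  have hap : 0 ≤ a / p := by positivity
  have haq : 0 ≤ (1 - a) / q := div_nonneg (by linarith) hq0.le
  set c₁ := ENNReal.ofReal ((lam ^ 2) ^ |w|)
  set c₂ := ENNReal.ofReal ((lam ^ 2) ^ |v|)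
  set c₃ : ℝ≥0∞ := 2 ^ (a * (1 + s * τ) + (1 - a))
  set c₄ := ENNReal.ofReal (lam - 1) ^ (-(1 / τ)) with hc₄
  have hl1 : 0 < lam - 1 := by linarith
  have hl0 : ENNReal.ofReal (lam - 1) ≠ 0 := by simpa using hlam
  refine ⟨2 * c₄ * c₃ * (c₁ ^ (a / p) * c₂ ^ ((1 - a) / q)), ?_, ?_⟩
  · refine ENNReal.mul_ne_top (ENNReal.mul_ne_top (ENNReal.mul_ne_top (by simp) ?_) ?_)
      (ENNReal.mul_ne_top ?_ ?_)
    · rw [hc₄, ENNReal.ofReal_rpow_of_pos hl1]; exact ENNReal.ofReal_ne_top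
    · exact ENNReal.rpow_ne_top_of_nonneg (by nlinarith [mul_pos hs hτ0]) (by simp)
    · exact ENNReal.rpow_ne_top_of_nonneg hap ENNReal.ofReal_ne_top
    · exact ENNReal.rpow_ne_top_of_nonneg haq ENNReal.ofReal_ne_top
  rintro g hg ⟨M, hM⟩ T hT
  have hT0 : ENNReal.ofReal T ≠ 0 := by simpa using hT
  have hTt : ENNReal.ofReal T ≠ ∞ := ENNReal.ofReal_ne_top
  have h12 : T < lam * T := by nlinarith
  have h23 : lam * T < lam ^ 2 * T := by nlinarith
  obtain ⟨m, hm⟩ := interval_gagliardo_nirenberg hs hp hq hτ ha0 ha1 hbal hg hM (h12.trans h23)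
  refine ⟨m, ?_⟩
  set I := Ico T (lam ^ 2 * T)
  set G := (∫⁻ x in I, ‖g x - m‖ₑ ^ τ) ^ (1 / τ)
  set N := ∫⁻ t in I, radialDensity s p w (lam ^ 2) g t with hN
  set Q := ∫⁻ t in I, ‖g t‖ₑ ^ q * ENNReal.ofReal (t ^ v) with hQ
  have hP : ∫⁻ x in I, gagliardoDensity s p g I x ≤ c₁ * ENNReal.ofReal T ^ (-w) * N := by
    refine (setLIntegral_le_weighted w hT hΛ _).trans ?_
    rw [hN]
    refine mul_le_mul' le_rfl ?_
    refine setLIntegral_mono' measurableSet_Ico fun t ht => ?_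
    rw [radialDensity]
    gcongr
    -- Two radii in the double shell have ratio at most lam², so the shell lies in the window of
    -- `radialDensity`.
    refine lintegral_mono_set fun r hr => ?_
    have ht1 := ht.1
    have ht2 := ht.2
    have hr1 := hr.1
    have hr2 := hr.2
    constructor
    · rw [inv_mul_le_iff₀ (by positivity)]; nlinarith
    · nlinarith
  have hQ' : ∫⁻ x in I, ‖g x‖ₑ ^ q ≤ c₂ * ENNReal.ofReal T ^ (-v) * Q :=
    setLIntegral_le_weighted v hT hΛ _
  have hG : G ≤ c₃ * ((c₁ * ENNReal.ofReal T ^ (-w) * N) ^ (a / p)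
      * (c₂ * ENNReal.ofReal T ^ (-v) * Q) ^ ((1 - a) / q)) := hm.trans (by gcongr)
  have hA := avgNorm_le_of_subset hτ0 (δ := (lam - 1) * T) (B := lam * T) (A := T) (by linarith)
    (I := I) (Ico_subset_Ico le_rfl h23.le) (fun x => g x - m)
  have hB := avgNorm_le_of_subset hτ0 (δ := (lam - 1) * T) (B := lam ^ 2 * T) (A := lam * T) (by nlinarith)
    (I := I) (Ico_subset_Ico h12.le le_rfl) (fun x => g x - m)
  have hcδ : ENNReal.ofReal ((lam - 1) * T) ^ (-(1 / τ)) = c₄ * ENNReal.ofReal T ^ (-(1 / τ)) := by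
    rw [ENNReal.ofReal_mul hl1.le,
      ENNReal.mul_rpow_of_ne_top ENNReal.ofReal_ne_top ENNReal.ofReal_ne_top]
  rw [hcδ] at hA hB
  have hTT : ENNReal.ofReal T ^ (-(1 / τ)) * (ENNReal.ofReal T ^ (-w * (a / p))
      * ENNReal.ofReal T ^ (-v * ((1 - a) / q))) = 1 := by
    rw [← ENNReal.rpow_add _ _ hT0 hTt, ← ENNReal.rpow_add _ _ hT0 hTt, ← ENNReal.rpow_zero]
    congr 1
    linarith
  calc _ ≤ c₄ * ENNReal.ofReal T ^ (-(1 / τ)) * G + c₄ * ENNReal.ofReal T ^ (-(1 / τ)) * G :=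
        add_le_add hA hB
    _ = 2 * c₄ * ENNReal.ofReal T ^ (-(1 / τ)) * G := by ring
    _ ≤ 2 * c₄ * ENNReal.ofReal T ^ (-(1 / τ)) * (c₃ * ((c₁ * ENNReal.ofReal T ^ (-w) * N) ^ (a / p)
      * (c₂ * ENNReal.ofReal T ^ (-v) * Q) ^ ((1 - a) / q))) := by gcongr
    _ = 2 * c₄ * c₃ * (c₁ ^ (a / p) * c₂ ^ ((1 - a) / q)) * (N ^ (a / p) * Q ^ ((1 - a) / q))
        * (ENNReal.ofReal T ^ (-(1 / τ)) * (ENNReal.ofReal T ^ (-w * (a / p))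
      * ENNReal.ofReal T ^ (-v * ((1 - a) / q)))) := by
        simp only [ENNReal.mul_rpow_of_nonneg _ _ hap, ENNReal.mul_rpow_of_nonneg _ _ haq,
          ← ENNReal.rpow_mul]
        ring
    _ = _ := by rw [hTT, mul_one]

/-! ### Telescoping along a chain of shells -/

lemma lintegral_rpow_mul_rpow_le {X : Type*} [MeasurableSpace X] (ν : Measure X)
    {f g : X → ℝ≥0∞} (hf : AEMeasurable f ν) (hg : AEMeasurable g ν) {A B : ℝ} (hA : 0 ≤ A)
    (hB : 0 ≤ B) (hAB : A + B ≤ 1) :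
    ∫⁻ x, f x ^ A * g x ^ B ∂ν
      ≤ (∫⁻ x, f x ∂ν) ^ A * (∫⁻ x, g x ∂ν) ^ B * ν univ ^ (1 - (A + B)) := by
  have := ENNReal.lintegral_prod_norm_pow_le (μ := ν) Finset.univ
    (f := ![f, g, fun _ => 1]) (p := ![A, B, 1 - (A + B)])
    (by intro i _; fin_cases i <;> simp [hf, hg, aemeasurable_const])
    (by simp [Fin.sum_univ_three])
    (by intro i _; fin_cases i <;> simp [hA, hB, hAB])
  simpa [Fin.prod_univ_three] using this

lemma sum_rpow_mul_rpow_le {ι : Type*} (F : Finset ι) (x y : ι → ℝ≥0∞) {A B : ℝ} (hA : 0 ≤ A)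
    (hB : 0 ≤ B) (hAB : A + B ≤ 1) :
    ∑ j ∈ F, x j ^ A * y j ^ B
      ≤ (∑ j ∈ F, x j) ^ A * (∑ j ∈ F, y j) ^ B * (F.card : ℝ≥0∞) ^ (1 - (A + B)) := by
  let _ : MeasurableSpace F := ⊤
  have := lintegral_rpow_mul_rpow_le (Measure.count : Measure F) (f := fun j => x j)
    (g := fun j => y j) (measurable_of_finite _).aemeasurable
    (measurable_of_finite _).aemeasurable hA hB hAB
  simpa [lintegral_count, tsum_fintype, Finset.sum_attach F (fun j => x j ^ A * y j ^ B),
    Finset.sum_attach F x, Finset.sum_attach F y] using this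

/-- The double shells overlap at most twice: each is the union of two consecutive members of a
disjoint family. -/
lemma sum_setLIntegral_shell_le {lam R : ℝ} (hlam : 1 < lam) (hR : 0 < R) (F : Finset ℤ)
    (f : ℝ → ℝ≥0∞) :
    ∑ j ∈ F, ∫⁻ t in Ico (R * lam ^ j) (lam ^ 2 * (R * lam ^ j)), f t
      ≤ 2 * ∫⁻ t in Ioi 0, f t := by
  have hl0 : 0 < lam := by linarith
  have hmono : Monotone fun j : ℤ => R * lam ^ j :=
    fun i j hij => mul_le_mul_of_nonneg_left (zpow_le_zpow_right₀ hlam.le hij) hR.le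
  have hdisj := hmono.pairwise_disjoint_on_Ico_succ
  simp only [Int.succ_eq_succ, Int.succ] at hdisj
  have hpos : ∀ j : ℤ, 0 < R * lam ^ j := fun j => by positivity
  have hone : ∀ F : Finset ℤ, ∑ j ∈ F, ∫⁻ t in Ico (R * lam ^ j) (R * lam ^ (j + 1)), f t
      ≤ ∫⁻ t in Ioi 0, f t := fun F => by
    rw [← lintegral_biUnion_finset (fun i _ j _ hij => hdisj hij) fun _ _ => measurableSet_Ico]
    refine lintegral_mono_set (iUnion₂_subset fun j _ t ht => (hpos j).trans_le ht.1)
  have hsplit : ∀ j : ℤ, ∫⁻ t in Ico (R * lam ^ j) (lam ^ 2 * (R * lam ^ j)), f t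
      ≤ (∫⁻ t in Ico (R * lam ^ j) (R * lam ^ (j + 1)), f t)
        + ∫⁻ t in Ico (R * lam ^ (j + 1)) (R * lam ^ (j + 1 + 1)), f t := fun j => by
    refine (lintegral_mono_set ?_).trans (lintegral_union_le _ _ _)
    refine (Ico_subset_Ico_union_Ico (b := R * lam ^ (j + 1))).trans_eq' ?_
    rw [zpow_add_one₀ hl0.ne', zpow_add_one₀ hl0.ne']
    congr 1
    ring
  calc _ ≤ ∑ j ∈ F, ((∫⁻ t in Ico (R * lam ^ j) (R * lam ^ (j + 1)), f t)
        + ∫⁻ t in Ico (R * lam ^ (j + 1)) (R * lam ^ (j + 1 + 1)), f t) :=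
        Finset.sum_le_sum fun j _ => hsplit j
    _ ≤ (∫⁻ t in Ioi 0, f t) + ∫⁻ t in Ioi 0, f t := by
        rw [Finset.sum_add_distrib]
        refine add_le_add (hone F) ?_
        have := hone (F.map (addRightEmbedding 1))
        simpa [Finset.sum_map] using this
    _ = _ := (two_mul _).symm

/-- The reduced, weighted Gagliardo seminorm (to the power `p`) of a radial profile. -/
def radialGagliardo (s p w Λ : ℝ) (g : ℝ → ℝ) : ℝ≥0∞ :=
  ∫⁻ t in Ioi 0, radialDensity s p w Λ g t

/-- The weighted `L^q` norm (to the power `q`) of a radial profile. -/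
def radialLq (q v : ℝ) (g : ℝ → ℝ) : ℝ≥0∞ :=
  ∫⁻ t in Ioi 0, ‖g t‖ₑ ^ q * ENNReal.ofReal (t ^ v)

/-- The first sequence runs through consecutive shells, and the `n`-th term of the second one is
the lower of its `n`-th and `(n + 1)`-st terms. -/
def IsShellPath (e e' : ℕ → ℤ) : Prop :=
  Function.Injective e' ∧ ∀ n, (e n = e' n ∧ e (n + 1) = e' n + 1) ∨
    (e (n + 1) = e' n ∧ e n = e' n + 1)

/-- Each step of the path costs one shell estimate, and the norm on the initial shell is zero.
Injectivity of e' makes the costs a sum over distinct double shells; Hölder with a third factor 1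
then produces the power of n. -/
lemma exists_avgNorm_path_le {s p q τ a w v lam : ℝ} (hs : 0 < s) (hp : 1 ≤ p) (hq : 1 ≤ q)
    (hτ : 1 ≤ τ) (ha0 : 0 < a) (ha1 : a ≤ 1) (hbal : 1 / τ = a * (1 / p - s) + (1 - a) * (1 / q))
    (hscale : 1 / τ + w * (a / p) + v * ((1 - a) / q) = 0) (hlam : 1 < lam) :
    ∃ C : ℝ≥0∞, C ≠ ∞ ∧ ∀ g : ℝ → ℝ, Measurable g → (∃ M, ∀ x, |g x| ≤ M) → ∀ R, 0 < R →
      ∀ e e' : ℕ → ℤ, IsShellPath e e' →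
      (∀ᵐ r, r ∈ Ico (R * lam ^ e 0) (R * lam ^ (e 0 + 1)) → g r = 0) → ∀ n,
      avgNorm τ (R * lam ^ e n) (R * lam ^ (e n + 1)) g
        ≤ C * (radialGagliardo s p w (lam ^ 2) g ^ (a / p) * radialLq q v g ^ ((1 - a) / q))
          * (n : ℝ≥0∞) ^ (1 - (a / p + (1 - a) / q)) := by
  have hp0 : 0 < p := by linarith
  have hq0 : 0 < q := by linarith
  have hτ0 : 0 < τ := by linarith
  have hl0 : 0 < lam := by linarith
  have hap : 0 ≤ a / p := by positivity
  have haq : 0 ≤ (1 - a) / q := div_nonneg (by linarith) hq0.le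
  have hκ : a / p + (1 - a) / q ≤ 1 := by
    have h1 : a / p ≤ a := div_le_self ha0.le hp
    have h2 : (1 - a) / q ≤ 1 - a := div_le_self (by linarith) hq
    linarith
  obtain ⟨C, hC, h⟩ := exists_shell_estimate (s := s) (w := w) (v := v) hs hp hq hτ ha0 ha1 hbal
    hscale hlam
  refine ⟨C * (2 ^ (a / p) * 2 ^ ((1 - a) / q)), ENNReal.mul_ne_top hC (ENNReal.mul_ne_top
    (ENNReal.rpow_ne_top_of_nonneg hap (by simp)) (ENNReal.rpow_ne_top_of_nonneg haq (by simp))), ?_⟩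
  intro g hg hM R hR e e' he hz n
  set x : ℤ → ℝ≥0∞ := fun j => avgNorm τ (R * lam ^ j) (R * lam ^ (j + 1)) g with hx
  set N : ℤ → ℝ≥0∞ := fun j =>
    ∫⁻ t in Ico (R * lam ^ j) (lam ^ 2 * (R * lam ^ j)), radialDensity s p w (lam ^ 2) g t with hN
  set Q : ℤ → ℝ≥0∞ := fun j =>
    ∫⁻ t in Ico (R * lam ^ j) (lam ^ 2 * (R * lam ^ j)), ‖g t‖ₑ ^ q * ENNReal.ofReal (t ^ v) with hQ
  have hstep : ∀ j, x j ≤ x (j + 1) + C * (N j ^ (a / p) * Q j ^ ((1 - a) / q)) ∧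
      x (j + 1) ≤ x j + C * (N j ^ (a / p) * Q j ^ ((1 - a) / q)) := by
    intro j
    have hT : 0 < R * lam ^ j := by positivity
    obtain ⟨m, hm⟩ := h g hg hM (R * lam ^ j) hT
    have e1 : R * lam ^ (j + 1) = lam * (R * lam ^ j) := by rw [zpow_add_one₀ hl0.ne']; ring
    have e2 : R * lam ^ (j + 1 + 1) = lam ^ 2 * (R * lam ^ j) := by
      rw [zpow_add_one₀ hl0.ne', zpow_add_one₀ hl0.ne']; ring
    have h12 : R * lam ^ j < lam * (R * lam ^ j) := by nlinarith
    have h23 : lam * (R * lam ^ j) < lam ^ 2 * (R * lam ^ j) := by nlinarith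
    simp only [hx, e1, e2]
    constructor
    · exact (avgNorm_le_avgNorm_add hτ h12 h23 hg m).trans (by gcongr)
    · refine (avgNorm_le_avgNorm_add hτ h23 h12 hg m).trans ?_
      rw [add_comm (avgNorm τ (lam * (R * lam ^ j)) _ _)]
      gcongr
  have hsum : ∀ n, x (e n) ≤ ∑ i ∈ Finset.range n,
      C * (N (e' i) ^ (a / p) * Q (e' i) ^ ((1 - a) / q)) := by
    intro n
    induction n with
    | zero =>
      simp only [hx, avgNorm, Finset.range_zero, Finset.sum_empty, nonpos_iff_eq_zero]
      rw [lintegral_smul_measure, setLIntegral_congr_fun_ae (g := fun _ => 0) measurableSet_Ico]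
      · simp [hτ0]
      · filter_upwards [hz] with r hr hr'
        simp [hr hr', hτ0]
    | succ n ih =>
      rw [Finset.sum_range_succ]
      refine le_trans ?_ (add_le_add_left ih _)
      rcases he.2 n with ⟨h1, h2⟩ | ⟨h1, h2⟩
      · rw [h1, h2]; exact (hstep _).2
      · rw [h1, h2]; exact (hstep _).1
  calc x (e n) ≤ _ := hsum n
    _ = C * ∑ j ∈ (Finset.range n).map ⟨e', he.1⟩, N j ^ (a / p) * Q j ^ ((1 - a) / q) := by
        rw [Finset.sum_map, Finset.mul_sum]; rfl
    _ ≤ C * ((2 * radialGagliardo s p w (lam ^ 2) g) ^ (a / p) * (2 * radialLq q v g) ^ ((1 - a) / q)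
          * (n : ℝ≥0∞) ^ (1 - (a / p + (1 - a) / q))) := by
        gcongr
        refine (sum_rpow_mul_rpow_le _ N Q hap haq hκ).trans ?_
        rw [Finset.card_map, Finset.card_range]
        gcongr
        · exact sum_setLIntegral_shell_le hlam hR _ _
        · exact sum_setLIntegral_shell_le hlam hR _ _
    _ = _ := by
        rw [ENNReal.mul_rpow_of_nonneg _ _ hap, ENNReal.mul_rpow_of_nonneg _ _ haq]
        ring

lemma setLIntegral_shell_le {τ lam T b : ℝ} (hτ : 0 < τ) (hlam : 1 < lam) (hT : 0 < T)
    (hb : 0 ≤ b) {W : ℝ → ℝ≥0∞} {g : ℝ → ℝ}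
    (hW : ∀ r ∈ Ico T (lam * T), W r ≤ ENNReal.ofReal (b * r⁻¹)) :
    ∫⁻ r in Ico T (lam * T), W r * ‖g r‖ₑ ^ τ
      ≤ ENNReal.ofReal (b * (lam - 1)) * avgNorm τ T (lam * T) g ^ τ := by
  have h1 : 0 < lam * T - T := by nlinarith
  have h2 : (ENNReal.ofReal (lam * T - T))⁻¹ = ENNReal.ofReal (lam * T - T)⁻¹ :=
    (ENNReal.ofReal_inv_of_pos h1).symm
  have hl : 0 < lam - 1 := by linarith
  rw [avgNorm, ← ENNReal.rpow_mul, one_div_mul_cancel hτ.ne', ENNReal.rpow_one,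
    lintegral_smul_measure, smul_eq_mul, ← mul_assoc, h2, ← ENNReal.ofReal_mul (by positivity),
    ← lintegral_const_mul' _ _ ENNReal.ofReal_ne_top]
  refine setLIntegral_mono' measurableSet_Ico fun r hr => ?_
  gcongr
  refine (hW r hr).trans (ENNReal.ofReal_le_ofReal ?_)
  have e : b * (lam - 1) * (lam * T - T)⁻¹ = b * T⁻¹ := by
    have : lam * T - T = (lam - 1) * T := by ring
    rw [this]; field_simp
  rw [e]
  have := hr.1
  gcongr

/-- The weight b n^(-μ)/r gives each shell a mass of order n^(-μ), while the path bound contributes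
n^((1-κ)τ). -/
lemma exists_weighted_estimate_of_bounded {s p q τ a w v lam μ b : ℝ} (hs : 0 < s) (hp : 1 ≤ p)
    (hq : 1 ≤ q) (hτ : 1 ≤ τ) (ha0 : 0 < a) (ha1 : a ≤ 1) (hτμ : τ ≤ μ) (hb : 0 ≤ b)
    (hbal : 1 / τ = a * (1 / p - s) + (1 - a) * (1 / q))
    (hscale : 1 / τ + w * (a / p) + v * ((1 - a) / q) = 0) (hlam : 1 < lam) :
    ∃ C : ℝ≥0∞, C ≠ ∞ ∧ ∀ g : ℝ → ℝ, Measurable g → (∃ M, ∀ x, |g x| ≤ M) → ∀ R, 0 < R →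
      ∀ e e' : ℕ → ℤ, IsShellPath e e' →
      (∀ᵐ r, r ∈ Ico (R * lam ^ e 0) (R * lam ^ (e 0 + 1)) → g r = 0) →
      ∀ W : ℝ → ℝ≥0∞, (∀ n : ℕ, ∀ r ∈ Ico (R * lam ^ e (n + 1)) (R * lam ^ (e (n + 1) + 1)),
        W r ≤ ENNReal.ofReal (b * ((n + 1 : ℕ) : ℝ) ^ (-μ) * r⁻¹)) →
      ∫⁻ r in ⋃ n : ℕ, Ico (R * lam ^ e (n + 1)) (R * lam ^ (e (n + 1) + 1)), W r * ‖g r‖ₑ ^ τ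
        ≤ C * (radialGagliardo s p w (lam ^ 2) g ^ (a / p)
            * radialLq q v g ^ ((1 - a) / q)) ^ τ := by
  have hp0 : 0 < p := by linarith
  have hq0 : 0 < q := by linarith
  have hτ0 : 0 < τ := by linarith
  have hl0 : 0 < lam := by linarith
  have hl1 : 0 < lam - 1 := by linarith
  set κ := a / p + (1 - a) / q with hκ
  -- This gain makes the series converge: -μ + (1-κ)τ = τ - μ - 1 - asτ < -1.
  have hκτ : κ * τ = 1 + a * s * τ := by
    have : κ = 1 / τ + a * s := by rw [hbal, hκ]; ring
    rw [this]; field_simp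
  obtain ⟨C, hC, h⟩ := exists_avgNorm_path_le (s := s) (w := w) (v := v) hs hp hq hτ ha0 ha1 hbal
    hscale hlam
  set f : ℕ → ℝ := fun n => b * (lam - 1) * ((n + 1 : ℕ) : ℝ) ^ (-μ + (1 - κ) * τ) with hf
  have hfs : Summable f := by
    apply Summable.mul_left
    refine (summable_nat_add_iff (f := fun n : ℕ => (n : ℝ) ^ (-μ + (1 - κ) * τ)) 1).2
      (Real.summable_nat_rpow.2 ?_)
    have : 0 < a * s * τ := by positivity
    nlinarith
  refine ⟨(∑' n, ENNReal.ofReal (f n)) * C ^ τ,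
    ENNReal.mul_ne_top hfs.tsum_ofReal_ne_top (ENNReal.rpow_ne_top_of_nonneg hτ0.le hC), ?_⟩
  intro g hg hM R hR e e' he hz W hW
  have hx := h g hg hM R hR e e' he hz
  set E := radialGagliardo s p w (lam ^ 2) g ^ (a / p) * radialLq q v g ^ ((1 - a) / q)
  refine (lintegral_iUnion_le _ _).trans ?_
  rw [mul_assoc, ← ENNReal.tsum_mul_right]
  refine ENNReal.tsum_le_tsum fun n => ?_
  have hT : 0 < R * lam ^ e (n + 1) := by positivity
  have hn : (0 : ℝ) < ((n + 1 : ℕ) : ℝ) := by positivity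
  have e1 : R * lam ^ (e (n + 1) + 1) = lam * (R * lam ^ e (n + 1)) := by
    rw [zpow_add_one₀ hl0.ne']; ring
  have h1 := setLIntegral_shell_le (g := g) (b := b * ((n + 1 : ℕ) : ℝ) ^ (-μ)) hτ0 hlam hT
    (by positivity) (by rw [← e1]; exact hW n)
  rw [← e1] at h1
  refine h1.trans ?_
  calc ENNReal.ofReal (b * ((n + 1 : ℕ) : ℝ) ^ (-μ) * (lam - 1))
        * avgNorm τ (R * lam ^ e (n + 1)) (R * lam ^ (e (n + 1) + 1)) g ^ τ
      ≤ ENNReal.ofReal (b * ((n + 1 : ℕ) : ℝ) ^ (-μ) * (lam - 1))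
        * (C * E * ((n + 1 : ℕ) : ℝ≥0∞) ^ (1 - κ)) ^ τ := by
        gcongr
        exact hx (n + 1)
    _ = ENNReal.ofReal (f n) * (C ^ τ * E ^ τ) := by
        rw [ENNReal.mul_rpow_of_nonneg _ _ hτ0.le, ENNReal.mul_rpow_of_nonneg _ _ hτ0.le,
          ← ENNReal.rpow_mul, ← ENNReal.ofReal_natCast, ENNReal.ofReal_rpow_of_pos hn, mul_comm,
          mul_assoc, ← ENNReal.ofReal_mul (by positivity), mul_comm (ENNReal.ofReal _)]
        congr 2
        simp only [hf]
        rw [Real.rpow_add hn]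
        ring

/-! ### Removing boundedness by truncation -/

/-- Truncation of `g` at height `k`. -/
def truncate (k : ℕ) (g : ℝ → ℝ) (r : ℝ) : ℝ := max (-(k : ℝ)) (min k (g r))

lemma measurable_truncate (k : ℕ) {g : ℝ → ℝ} (hg : Measurable g) : Measurable (truncate k g) := by
  unfold truncate; fun_prop

lemma abs_truncate_le (k : ℕ) (g : ℝ → ℝ) (r : ℝ) : |truncate k g r| ≤ k := by
  have hk : (0 : ℝ) ≤ k := k.cast_nonneg
  rw [truncate, abs_le]
  exact ⟨le_max_left _ _, max_le (by linarith) (min_le_left _ _)⟩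

lemma abs_truncate_sub_le (k : ℕ) (g : ℝ → ℝ) (r t : ℝ) :
    |truncate k g r - truncate k g t| ≤ |g r - g t| :=
  (abs_max_sub_max_le_max _ _ _ _).trans (max_le (by simp) (by
    refine (abs_min_sub_min_le_max _ _ _ _).trans (max_le (by simp) le_rfl)))

lemma truncate_of_eq_zero (k : ℕ) {g : ℝ → ℝ} {r : ℝ} (h : g r = 0) : truncate k g r = 0 := by
  simp [truncate, h]

lemma abs_truncate_le_abs (k : ℕ) (g : ℝ → ℝ) (r : ℝ) : |truncate k g r| ≤ |g r| := by
  have := abs_le.1 (le_refl |g r|)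
  have hk : (0 : ℝ) ≤ k := k.cast_nonneg
  have h0 := abs_nonneg (g r)
  rw [truncate, abs_le]
  constructor
  · exact (le_min (by linarith) this.1).trans (le_max_right _ _)
  · exact max_le (by linarith) ((min_le_right _ _).trans this.2)

lemma truncate_of_abs_le {k : ℕ} {g : ℝ → ℝ} {r : ℝ} (h : |g r| ≤ k) : truncate k g r = g r := by
  rw [abs_le] at h
  rw [truncate, min_eq_right h.2, max_eq_right h.1]

lemma radialGagliardo_truncate_le {s p w Λ : ℝ} (hp : 0 ≤ p) (k : ℕ) (g : ℝ → ℝ) :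
    radialGagliardo s p w Λ (truncate k g) ≤ radialGagliardo s p w Λ g := by
  unfold radialGagliardo radialDensity gagliardoDensity
  refine lintegral_mono fun t => mul_le_mul' (lintegral_mono fun r => ENNReal.ofReal_le_ofReal ?_)
    le_rfl
  exact mul_le_mul_of_nonneg_right
    (Real.rpow_le_rpow (abs_nonneg _) (abs_truncate_sub_le k g t r) hp) (by positivity)

lemma radialLq_truncate_le {q v : ℝ} (hq : 0 ≤ q) (k : ℕ) (g : ℝ → ℝ) :
    radialLq q v (truncate k g) ≤ radialLq q v g := by
  unfold radialLq
  gcongr with t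
  rw [Real.enorm_eq_ofReal_abs, Real.enorm_eq_ofReal_abs]
  exact ENNReal.ofReal_le_ofReal (abs_truncate_le_abs k g t)

/-- Truncation increases neither norm on the right, preserves zeros, and is eventually equal to g at
each point; Fatou's lemma concludes. -/
lemma exists_weighted_estimate {s p q τ a w v lam μ b : ℝ} (hs : 0 < s) (hp : 1 ≤ p)
    (hq : 1 ≤ q) (hτ : 1 ≤ τ) (ha0 : 0 < a) (ha1 : a ≤ 1) (hτμ : τ ≤ μ) (hb : 0 ≤ b)
    (hbal : 1 / τ = a * (1 / p - s) + (1 - a) * (1 / q))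
    (hscale : 1 / τ + w * (a / p) + v * ((1 - a) / q) = 0) (hlam : 1 < lam) :
    ∃ C : ℝ≥0∞, C ≠ ∞ ∧ ∀ g : ℝ → ℝ, Measurable g → ∀ R, 0 < R →
      ∀ e e' : ℕ → ℤ, IsShellPath e e' →
      (∀ᵐ r, r ∈ Ico (R * lam ^ e 0) (R * lam ^ (e 0 + 1)) → g r = 0) →
      ∀ W : ℝ → ℝ≥0∞, Measurable W →
      (∀ n : ℕ, ∀ r ∈ Ico (R * lam ^ e (n + 1)) (R * lam ^ (e (n + 1) + 1)),
        W r ≤ ENNReal.ofReal (b * ((n + 1 : ℕ) : ℝ) ^ (-μ) * r⁻¹)) →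
      ∫⁻ r in ⋃ n : ℕ, Ico (R * lam ^ e (n + 1)) (R * lam ^ (e (n + 1) + 1)), W r * ‖g r‖ₑ ^ τ
        ≤ C * (radialGagliardo s p w (lam ^ 2) g ^ (a / p)
            * radialLq q v g ^ ((1 - a) / q)) ^ τ := by
  obtain ⟨C, hC, h⟩ := exists_weighted_estimate_of_bounded (s := s) (w := w) (v := v) hs hp hq hτ
    ha0 ha1 hτμ hb hbal hscale hlam
  refine ⟨C, hC, ?_⟩
  intro g hg R hR e e' he hz W hWm hW
  have hτ0 : 0 < τ := by linarith
  have hp0 : 0 < p := by linarith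
  have hq0 : 0 < q := by linarith
  have hap : 0 ≤ a / p := by positivity
  have haq : 0 ≤ (1 - a) / q := div_nonneg (by linarith) hq0.le
  set S := ⋃ n : ℕ, Ico (R * lam ^ e (n + 1)) (R * lam ^ (e (n + 1) + 1))
  have hbound : ∀ k : ℕ, ∫⁻ r in S, W r * ‖truncate k g r‖ₑ ^ τ
      ≤ C * (radialGagliardo s p w (lam ^ 2) g ^ (a / p)
            * radialLq q v g ^ ((1 - a) / q)) ^ τ := fun k => by
    refine (h (truncate k g) (measurable_truncate k hg) ⟨k, abs_truncate_le k g⟩ R hR e e' he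
      (hz.mono fun r hr hr' => truncate_of_eq_zero k (hr hr')) W hW).trans ?_
    gcongr
    · exact radialGagliardo_truncate_le hp0.le k g
    · exact radialLq_truncate_le hq0.le k g
  calc ∫⁻ r in S, W r * ‖g r‖ₑ ^ τ
      = ∫⁻ r in S, liminf (fun k : ℕ => W r * ‖truncate k g r‖ₑ ^ τ) atTop := by
        congr 1 with r
        refine (Tendsto.liminf_eq (tendsto_const_nhds.congr' ?_)).symm
        obtain ⟨K, hK⟩ := exists_nat_ge |g r|
        filter_upwards [eventually_ge_atTop K] with k hk
        rw [truncate_of_abs_le (hK.trans (by exact_mod_cast hk))]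
    _ ≤ liminf (fun k : ℕ => ∫⁻ r in S, W r * ‖truncate k g r‖ₑ ^ τ) atTop :=
        lintegral_liminf_le fun k => by
          have := measurable_truncate k hg
          fun_prop
    _ ≤ _ := liminf_le_of_le (by isBoundedDefault) fun b hb => by
        obtain ⟨k, hk⟩ := hb.exists
        exact hk.trans (hbound k)

/-! ### Polar coordinates, spherical caps and radial profiles -/

section Polar

variable {E : Type*} [NormedAddCommGroup E] [NormedSpace ℝ E] [MeasurableSpace E] [BorelSpace E]
  [FiniteDimensional ℝ E] [Nontrivial E] (ν : Measure E) [ν.IsAddHaarMeasure]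

lemma lintegral_polar {F : E → ℝ≥0∞} (hF : Measurable F) :
    ∫⁻ x, F x ∂ν = ∫⁻ ω : sphere (0 : E) 1, ∫⁻ r in Ioi (0 : ℝ),
      ENNReal.ofReal (r ^ (Module.finrank ℝ E - 1)) * F (r • (ω : E)) ∂volume ∂ν.toSphere := by
  have h1 : ∫⁻ x, F x ∂ν = ∫⁻ x : ({0}ᶜ : Set E), F x ∂(ν.comap (↑)) := by
    rw [lintegral_subtype_comap (measurableSet_singleton _).compl, restrict_compl_singleton]
  have h2 := (ν.measurePreserving_homeomorphUnitSphereProd.symm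
    (homeomorphUnitSphereProd E).toMeasurableEquiv).lintegral_comp_emb
    ((homeomorphUnitSphereProd E).toMeasurableEquiv.symm.measurableEmbedding)
    (fun x : ({0}ᶜ : Set E) => F x)
  rw [h1, ← h2]
  have h3 : ∀ z : sphere (0 : E) 1 × Ioi (0 : ℝ),
      F ((homeomorphUnitSphereProd E).toMeasurableEquiv.symm z) = F (z.2.1 • z.1.1) := fun z => by
    rfl
  simp_rw [h3]
  rw [lintegral_prod _ (by fun_prop)]
  refine lintegral_congr fun ω => ?_
  rw [Measure.volumeIoiPow, lintegral_withDensity_eq_lintegral_mul _ (by fun_prop) (by fun_prop)]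
  exact lintegral_subtype_comap measurableSet_Ioi
    fun r : ℝ => ENNReal.ofReal (r ^ (Module.finrank ℝ E - 1)) * F (r • (ω : E))

lemma lintegral_comp_norm {F : ℝ → ℝ≥0∞} (hF : Measurable F) :
    ∫⁻ x : E, F ‖x‖ ∂ν = ν.toSphere univ * ∫⁻ r in Ioi (0 : ℝ),
      ENNReal.ofReal (r ^ (Module.finrank ℝ E - 1)) * F r := by
  rw [lintegral_polar ν (F := fun x => F ‖x‖) (by fun_prop), mul_comm, ← lintegral_const]
  refine lintegral_congr fun ω => setLIntegral_congr_fun measurableSet_Ioi fun r hr => ?_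
  simp [norm_smul, abs_of_pos (mem_Ioi.1 hr)]

/-- The ball of radius δ about e has volume of order δ^n, n being the dimension. In polar
coordinates it lies over the cap of radius 2δ, with radii in (1-δ, 1+δ), which leaves δ^(n-1) for
the cap. -/
lemma exists_toSphere_ball_ge :
    ∃ c : ℝ, 0 < c ∧ ∀ (e : sphere (0 : E) 1) (δ : ℝ), 0 < δ → δ ≤ 1 →
      ENNReal.ofReal (c * δ ^ (Module.finrank ℝ E - 1)) ≤ ν.toSphere (ball e (2 * δ)) := by
  set n := Module.finrank ℝ E with hn
  have hn0 : 0 < n := Module.finrank_pos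
  have hb : 0 < ν.real (ball (0 : E) 1) := 
    ENNReal.toReal_pos (measure_ball_pos ν _ one_pos).ne' measure_ball_lt_top.ne
  refine ⟨ν.real (ball (0 : E) 1) / 2 ^ n, by positivity, fun e δ hδ hδ1 => ?_⟩
  have h1 : ν (ball (e : E) δ) ≤ ν.toSphere (ball e (2 * δ)) * ENNReal.ofReal (2 ^ n * δ) := by
    calc ν (ball (e : E) δ) = ∫⁻ x, (ball (e : E) δ).indicator 1 x ∂ν := by
          rw [lintegral_indicator_one measurableSet_ball]
      _ = ∫⁻ ω : sphere (0 : E) 1, ∫⁻ r in Ioi (0 : ℝ),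
            ENNReal.ofReal (r ^ (n - 1)) * (ball (e : E) δ).indicator 1 (r • (ω : E))
              ∂volume ∂ν.toSphere :=
          lintegral_polar ν (measurable_one.indicator measurableSet_ball)
      _ ≤ ∫⁻ ω : sphere (0 : E) 1, (ball e (2 * δ)).indicator 1 ω * ∫⁻ r in Ioi (0 : ℝ),
            (Ioo (1 - δ) (1 + δ)).indicator (fun _ => ENNReal.ofReal (2 ^ (n - 1))) r
              ∂volume ∂ν.toSphere := by
          refine lintegral_mono fun ω => ?_
          dsimp only
          rw [← lintegral_const_mul _ (measurable_const.indicator measurableSet_Ioo)]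
          refine setLIntegral_mono' measurableSet_Ioi fun r (hr : 0 < r) => ?_
          by_cases hmem : r • (ω : E) ∈ ball (e : E) δ
          · have hω : ‖(ω : E)‖ = 1 := by simp
            have he : ‖(e : E)‖ = 1 := by simp
            rw [mem_ball, dist_eq_norm] at hmem
            have hr1 : |r - 1| < δ := by
              have := abs_norm_sub_norm_le (r • (ω : E)) e
              rw [norm_smul, hω, he, mul_one, Real.norm_of_nonneg hr.le] at this
              exact this.trans_lt hmem
            have hr2 := abs_lt.1 hr1
            have hωe : ω ∈ ball e (2 * δ) := by
              rw [mem_ball, Subtype.dist_eq, dist_eq_norm]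
              calc ‖(ω : E) - e‖ = ‖(1 - r) • (ω : E) + (r • (ω : E) - e)‖ := by
                    congr 1; rw [sub_smul, one_smul]; abel
                _ ≤ ‖(1 - r) • (ω : E)‖ + ‖r • (ω : E) - e‖ := norm_add_le _ _
                _ < δ + δ := by
                    refine add_lt_add ?_ hmem
                    rwa [norm_smul, hω, mul_one, Real.norm_eq_abs, abs_sub_comm]
                _ = 2 * δ := by ring
            rw [indicator_of_mem hωe, indicator_of_mem (show r ∈ Ioo (1 - δ) (1 + δ) from
              ⟨by linarith, by linarith⟩), indicator_of_mem (by rwa [mem_ball, dist_eq_norm])]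
            simp only [Pi.one_apply, mul_one, one_mul]
            gcongr
            linarith
          · rw [indicator_of_notMem hmem, mul_zero]
            exact zero_le
      _ ≤ ∫⁻ ω : sphere (0 : E) 1, (ball e (2 * δ)).indicator 1 ω * ENNReal.ofReal (2 ^ n * δ)
              ∂ν.toSphere := by
          gcongr with ω
          refine (setLIntegral_le_lintegral _ _).trans ?_
          rw [lintegral_indicator_const measurableSet_Ioo, Real.volume_Ioo,
            ← ENNReal.ofReal_mul (by positivity)]
          apply ENNReal.ofReal_le_ofReal
          rw [← Nat.sub_add_cancel hn0, pow_succ]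
          apply le_of_eq
          simp only [Nat.add_sub_cancel]
          ring
      _ = _ := by
          rw [lintegral_mul_const' _ _ ENNReal.ofReal_ne_top,
            lintegral_indicator_one measurableSet_ball]
  rw [Measure.addHaar_ball_of_pos _ _ hδ, ← hn, ← ENNReal.ofReal_toReal (a := ν (ball 0 1))
    measure_ball_lt_top.ne, ← ENNReal.ofReal_mul (by positivity)] at h1
  have hpos : 0 < 2 ^ n * δ := by positivity
  rw [← ENNReal.mul_le_mul_iff_left (c := ENNReal.ofReal (2 ^ n * δ)) (by simpa using hpos)
    ENNReal.ofReal_ne_top, ← ENNReal.ofReal_mul (by positivity)]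
  refine le_trans (le_of_eq ?_) h1
  congr 1
  obtain ⟨k, hk⟩ : ∃ k, n = k + 1 := ⟨n - 1, by omega⟩
  rw [hk, Nat.add_sub_cancel, measureReal_def]
  field_simp
  ring

/-- Only directions near y/|y| are kept: on a cap of radius comparable to |r - |y||/r, the distance
from rω to y is at most 2|r - |y||. -/
lemma exists_lintegral_sphere_kernel_ge {D Λ : ℝ} (hD : 0 ≤ D) (hΛ : 1 < Λ) :
    ∃ c : ℝ, 0 < c ∧ ∀ (y : E) (r : ℝ), y ≠ 0 → Λ⁻¹ * ‖y‖ ≤ r → r ≤ Λ * ‖y‖ → r ≠ ‖y‖ →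
      ENNReal.ofReal (c * (|r - ‖y‖| ^ ((Module.finrank ℝ E - 1 : ℕ) - D)
          * (r ^ (Module.finrank ℝ E - 1))⁻¹))
        ≤ ∫⁻ ω : sphere (0 : E) 1, ENNReal.ofReal (‖r • (ω : E) - y‖ ^ (-D)) ∂ν.toSphere := by
  obtain ⟨c, hc, hcap⟩ := exists_toSphere_ball_ge ν
  set k := Module.finrank ℝ E - 1
  have hΛ0 : 0 < Λ := by linarith
  refine ⟨c * 2 ^ (-D) * ((2 * Λ) ^ k)⁻¹, by positivity, fun y r hy h1 h2 h3 => ?_⟩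
  have ht : 0 < ‖y‖ := norm_pos_iff.2 hy
  set t := ‖y‖ with htd
  have hr : 0 < r := lt_of_lt_of_le (by positivity) h1
  have hrt : 0 < |r - t| := abs_pos.2 (sub_ne_zero.2 h3)
  rw [inv_mul_le_iff₀ hΛ0] at h1
  have hle : |r - t| ≤ Λ * r := by rw [abs_le]; constructor <;> nlinarith
  let e : sphere (0 : E) 1 := ⟨t⁻¹ • y, by
    simp [norm_smul, ← htd, abs_of_pos ht, ht.ne']⟩
  have hye : y = t • (e : E) := by simp [e, ht.ne']
  -- The factor 2Λ ensures δ ≤ 1 and makes the angular displacement 2δr at most |r - t|.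
  set δ := |r - t| / (2 * Λ * r) with hδd
  have hδ : 0 < δ := by positivity
  have hδ1 : δ ≤ 1 := by rw [hδd, div_le_one (by positivity)]; nlinarith
  calc _ = ENNReal.ofReal ((2 * |r - t|) ^ (-D)) * ENNReal.ofReal (c * δ ^ k) := by
        rw [← ENNReal.ofReal_mul (by positivity)]
        congr 1
        rw [Real.mul_rpow (by simp) hrt.le, Real.rpow_sub hrt, Real.rpow_neg hrt.le,
          Real.rpow_natCast, hδd, div_pow, mul_pow (2 * Λ)]
        field_simp
    _ ≤ ENNReal.ofReal ((2 * |r - t|) ^ (-D)) * ν.toSphere (ball e (2 * δ)) := by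
        gcongr
        exact hcap e δ hδ hδ1
    _ = ∫⁻ ω in ball e (2 * δ), ENNReal.ofReal ((2 * |r - t|) ^ (-D)) ∂ν.toSphere := by
        rw [setLIntegral_const]
    _ ≤ ∫⁻ ω in ball e (2 * δ), ENNReal.ofReal (‖r • (ω : E) - y‖ ^ (-D)) ∂ν.toSphere := by
        refine setLIntegral_mono' measurableSet_ball fun ω hω => ENNReal.ofReal_le_ofReal ?_
        have hω1 : ‖(ω : E)‖ = 1 := by simp
        have he1 : ‖(e : E)‖ = 1 := by simp
        rw [mem_ball, Subtype.dist_eq, dist_eq_norm] at hω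
        refine Real.rpow_le_rpow_of_nonpos ?_ ?_ (by linarith)
        · rw [norm_pos_iff, sub_ne_zero]
          intro h
          have := congrArg norm h
          rw [norm_smul, hω1, mul_one, Real.norm_of_nonneg hr.le] at this
          exact h3 this
        · calc ‖r • (ω : E) - y‖ = ‖r • ((ω : E) - e) + (r - t) • (e : E)‖ := by
                congr 1; rw [hye, smul_sub, sub_smul]; abel
            _ ≤ ‖r • ((ω : E) - e)‖ + ‖(r - t) • (e : E)‖ := norm_add_le _ _
            _ = r * ‖(ω : E) - e‖ + |r - t| := by
                rw [norm_smul, norm_smul, he1, Real.norm_of_nonneg hr.le, mul_one,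
                  Real.norm_eq_abs]
            _ ≤ r * (2 * δ) + |r - t| := by gcongr
            _ ≤ 2 * |r - t| := by
                have : r * (2 * δ) = |r - t| / Λ := by rw [hδd]; field_simp
                rw [this]
                have := div_le_self hrt.le hΛ.le
                linarith
    _ ≤ _ := setLIntegral_le_lintegral _ _

lemma ae_comp_norm_of_ae {P : ℝ → Prop} (h : ∀ᵐ r, 0 < r → P r) : ∀ᵐ x ∂ν, P ‖x‖ := by
  obtain ⟨Z, hZ, hZm, hZ0⟩ := exists_measurable_superset_of_null (ae_iff.1 h)
  have h1 := lintegral_comp_norm ν (F := Z.indicator 1) (measurable_one.indicator hZm)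
  have h2 : ∫⁻ r in Ioi (0 : ℝ), ENNReal.ofReal (r ^ (Module.finrank ℝ E - 1)) *
      Z.indicator 1 r = 0 := by
    rw [← nonpos_iff_eq_zero]
    refine (setLIntegral_le_lintegral _ _).trans_eq ?_
    rw [lintegral_eq_zero_iff' (by
      have : Measurable (Z.indicator (1 : ℝ → ℝ≥0∞)) := measurable_one.indicator hZm
      fun_prop)]
    filter_upwards [measure_eq_zero_iff_ae_notMem.1 hZ0] with r hr
    simp [hr]
  rw [h2, mul_zero, lintegral_eq_zero_iff (by
    have : Measurable (Z.indicator (1 : ℝ → ℝ≥0∞)) := measurable_one.indicator hZm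
    fun_prop)] at h1
  have h0 : ∀ᵐ x ∂ν, x ≠ 0 := by simp [ae_iff]
  filter_upwards [h1, h0] with x hx hx0
  by_contra hP
  have : ‖x‖ ∈ Z := hZ (by simpa [hx0] using hP)
  simp [this] at hx

lemma ae_of_ae_comp_norm {P : ℝ → Prop} (hP : MeasurableSet {r | P r})
    (h : ∀ᵐ x ∂ν, P ‖x‖) : ∀ᵐ r, 0 < r → P r := by
  have h1 := lintegral_comp_norm ν (F := {r | P r}ᶜ.indicator 1) (measurable_one.indicator hP.compl)
  have h2 : ∫⁻ x, {r | P r}ᶜ.indicator (1 : ℝ → ℝ≥0∞) ‖x‖ ∂ν = 0 := by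
    rw [lintegral_eq_zero_iff (by
      have : Measurable ({r | P r}ᶜ.indicator (1 : ℝ → ℝ≥0∞)) := measurable_one.indicator hP.compl
      fun_prop)]
    filter_upwards [h] with x hx
    simp [hx]
  have h3 : ν.toSphere univ ≠ 0 := Measure.measure_univ_ne_zero.2 ν.toSphere_ne_zero
  rw [h2, eq_comm, mul_eq_zero, or_iff_right h3, lintegral_eq_zero_iff (by
      have : Measurable ({r | P r}ᶜ.indicator (1 : ℝ → ℝ≥0∞)) := measurable_one.indicator hP.compl
      fun_prop), EventuallyEq, ae_restrict_iff' measurableSet_Ioi] at h1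
  filter_upwards [h1] with r hr hr0
  by_contra hPr
  have h4 := hr hr0
  have h5 : 0 < r ^ (Module.finrank ℝ E - 1) := by positivity
  rw [indicator_of_mem (by exact hPr)] at h4
  simp [h5.not_ge] at h4

/-- A measurable function that is almost everywhere a function of the norm has a measurable
radial profile. -/
lemma exists_measurable_profile {u : E → ℝ} (hu : AEMeasurable u ν) {f : ℝ → ℝ}
    (hf : ∀ᵐ x ∂ν, u x = f ‖x‖) : ∃ g : ℝ → ℝ, Measurable g ∧ ∀ᵐ x ∂ν, u x = g ‖x‖ := by
  obtain ⟨u', hu', huu'⟩ := hu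
  have h1 : ∀ᵐ x ∂ν, u' x = f ‖x‖ := by
    filter_upwards [hf, huu'] with x h1 h2
    rw [← h2, h1]
  obtain ⟨Z, hZ, hZm, hZ0⟩ := exists_measurable_superset_of_null (ae_iff.1 h1)
  have hZi : Measurable (Z.indicator (1 : E → ℝ≥0∞)) := measurable_one.indicator hZm
  have h2 := lintegral_polar ν hZi
  rw [lintegral_indicator_one hZm, hZ0, eq_comm, lintegral_eq_zero_iff (by
    apply Measurable.lintegral_prod_right' (f := fun z : sphere (0 : E) 1 × ℝ =>
      ENNReal.ofReal (z.2 ^ (Module.finrank ℝ E - 1)) * Z.indicator 1 (z.2 • (z.1 : E)))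
    fun_prop)] at h2
  have : NeZero ν.toSphere := ⟨ν.toSphere_ne_zero⟩
  -- By Fubini, along almost every ray the measurable representative agrees a.e. with f; its
  -- restriction to one such ray is the profile.
  obtain ⟨ω, hω⟩ := h2.exists
  dsimp only [Pi.zero_apply] at hω
  rw [lintegral_eq_zero_iff (by fun_prop), EventuallyEq, ae_restrict_iff' measurableSet_Ioi] at hω
  have h3 : ∀ᵐ r : ℝ, 0 < r → f r = u' (r • (ω : E)) := by
    filter_upwards [hω] with r hr hr0
    by_contra hne
    have h4 := hr hr0
    have h5 : 0 < r ^ (Module.finrank ℝ E - 1) := by positivity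
    rw [indicator_of_mem (hZ (by
      simpa [norm_smul, abs_of_pos hr0] using fun h => hne h.symm))] at h4
    simp [h5.not_ge] at h4
  refine ⟨fun r => u' (r • (ω : E)), by fun_prop, ?_⟩
  filter_upwards [hf, ae_comp_norm_of_ae ν h3] with x h4 h5
  rw [h4, h5]

end Polar

/-! ### Reduction of the norms on ℝ^d to norms of the profile -/

variable {d : ℕ}

lemma gagliardo_congr_ae (s p α Λ : ℝ) {u v : EuclideanSpace ℝ (Fin d) → ℝ}
    (h : ∀ᵐ x, u x = v x) : gagliardo s p α Λ u = gagliardo s p α Λ v := by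
  unfold gagliardo
  congr 1
  refine lintegral_congr_ae ?_
  filter_upwards [h] with y hy
  refine lintegral_congr_ae ?_
  filter_upwards [h] with x hx
  rw [hx, hy]

lemma measurable_chi (Λ t : ℝ) : Measurable fun r => chi Λ r t := by
  unfold chi
  refine Measurable.ite ?_ measurable_const measurable_const
  have h1 : MeasurableSet {r : ℝ | Λ⁻¹ * r ≤ t} := measurableSet_le (by fun_prop) (by fun_prop)
  have h2 : MeasurableSet {r : ℝ | t ≤ Λ * r} := measurableSet_le (by fun_prop) (by fun_prop)
  exact h1.inter h2

lemma chi_eq_one {Λ r t : ℝ} (hΛ : 0 < Λ) (h : r ∈ Icc (Λ⁻¹ * t) (Λ * t)) : chi Λ r t = 1 := by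
  have h1 := h.1
  have h2 := h.2
  rw [inv_mul_le_iff₀ hΛ] at h1
  rw [chi, if_pos ⟨by rwa [inv_mul_le_iff₀ hΛ], h1⟩]

lemma rpow_ge_of_mem {Λ r t k : ℝ} (hΛ : 1 < Λ) (ht : 0 < t) (h : r ∈ Icc (Λ⁻¹ * t) (Λ * t)) :
    Λ ^ (-|k|) * t ^ k ≤ r ^ k := by
  have hΛ0 : 0 < Λ := by linarith
  have h1 := h.1
  have hr : 0 < r := lt_of_lt_of_le (by positivity) h1
  rcases le_total 0 k with hk | hk
  · calc Λ ^ (-|k|) * t ^ k = (Λ⁻¹ * t) ^ k := by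
          rw [abs_of_nonneg hk, Real.mul_rpow (by positivity) ht.le, Real.inv_rpow hΛ0.le,
            Real.rpow_neg hΛ0.le]
      _ ≤ r ^ k := Real.rpow_le_rpow (by positivity) h1 hk
  · calc Λ ^ (-|k|) * t ^ k = (Λ * t) ^ k := by
          rw [abs_of_nonpos hk, neg_neg, Real.mul_rpow hΛ0.le ht.le]
      _ ≤ r ^ k := Real.rpow_le_rpow_of_nonpos hr h.2 hk

/-- The spherical kernel bound lowers the singularity from d + sp to 1 + sp and cancels the Jacobian
r^(d-1). Since |r - t| ≤ Λt in the window, |r - t|^(-(s-s')p) is bounded below by a multiple of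
t^(-(s-s')p), which trades s for s'. -/
lemma exists_gagliardoDensity_le_lintegral (hd : 1 ≤ d) {s s' p α Λ : ℝ} (hs : 0 < s) (hss : s' ≤ s)
    (hp : 0 < p) (hΛ : 1 < Λ) :
    ∃ c : ℝ, 0 < c ∧ ∀ g : ℝ → ℝ, Measurable g → ∀ y : EuclideanSpace ℝ (Fin d), y ≠ 0 →
      ENNReal.ofReal c * (gagliardoDensity s' p g (Icc (Λ⁻¹ * ‖y‖) (Λ * ‖y‖)) ‖y‖
          * ENNReal.ofReal (‖y‖ ^ (α * p - (s - s') * p)))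
        ≤ ∫⁻ x : EuclideanSpace ℝ (Fin d), ENNReal.ofReal
          (|g ‖x‖ - g ‖y‖| ^ p * ‖x‖ ^ (α * p) / ‖x - y‖ ^ ((d : ℝ) + s * p) * chi Λ ‖x‖ ‖y‖) := by
  have : Nonempty (Fin d) := ⟨⟨0, hd⟩⟩
  have hΛ0 : 0 < Λ := by linarith
  have hD : 0 ≤ (d : ℝ) + s * p := by positivity
  obtain ⟨c, hc, hker⟩ := exists_lintegral_sphere_kernel_ge
    (volume : Measure (EuclideanSpace ℝ (Fin d))) hD hΛ
  have hdim : Module.finrank ℝ (EuclideanSpace ℝ (Fin d)) = d := by simp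
  rw [hdim] at hker
  refine ⟨c * Λ ^ (-|α * p|) * Λ ^ (-((s - s') * p)), by positivity, fun g hg y hy => ?_⟩
  have ht : 0 < ‖y‖ := norm_pos_iff.2 hy
  have hchi := measurable_chi Λ ‖y‖
  rw [lintegral_polar _ (by fun_prop), hdim]
  set t := ‖y‖ with htd
  have hIcc : Icc (Λ⁻¹ * t) (Λ * t) ⊆ Ioi 0 := fun r hr => lt_of_lt_of_le (by positivity) hr.1
  calc ENNReal.ofReal (c * Λ ^ (-|α * p|) * Λ ^ (-((s - s') * p)))
        * (gagliardoDensity s' p g (Icc (Λ⁻¹ * t) (Λ * t)) t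
          * ENNReal.ofReal (t ^ (α * p - (s - s') * p)))
      = ∫⁻ r in Icc (Λ⁻¹ * t) (Λ * t), ENNReal.ofReal (c * Λ ^ (-|α * p|) * Λ ^ (-((s - s') * p))
          * t ^ (α * p - (s - s') * p)) *
          ENNReal.ofReal (|g t - g r| ^ p * |t - r| ^ (-(1 + s' * p))) := by
        rw [lintegral_const_mul' _ _ ENNReal.ofReal_ne_top,
          ENNReal.ofReal_mul (q := t ^ (α * p - (s - s') * p)) (by positivity), gagliardoDensity]
        ring
    _ ≤ ∫⁻ r in Icc (Λ⁻¹ * t) (Λ * t), ENNReal.ofReal (r ^ (d - 1) * (|g r - g t| ^ p * r ^ (α * p)))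
          * ∫⁻ ω : sphere (0 : EuclideanSpace ℝ (Fin d)) 1, ENNReal.ofReal
            (‖r • (ω : EuclideanSpace ℝ (Fin d)) - y‖ ^ (-((d : ℝ) + s * p)))
              ∂(volume : Measure (EuclideanSpace ℝ (Fin d))).toSphere := by
        refine setLIntegral_mono' measurableSet_Icc fun r hr => ?_
        have hr0 : 0 < r := hIcc hr
        rcases eq_or_ne r t with rfl | hrt
        · simp [Real.zero_rpow hp.ne']
        have hrt' : 0 < |r - t| := abs_pos.2 (sub_ne_zero.2 hrt)
        refine le_trans ?_ (mul_le_mul' le_rfl (hker y r hy hr.1 hr.2 hrt))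
        rw [← ENNReal.ofReal_mul (by positivity), ← ENNReal.ofReal_mul (by positivity)]
        apply ENNReal.ofReal_le_ofReal
        have h1 := rpow_ge_of_mem (k := α * p) hΛ ht hr
        have hle : |r - t| ≤ Λ * t := by
          have h3 := hr.1
          have h4 := hr.2
          rw [abs_le]; constructor <;> nlinarith
        have h2 : Λ ^ (-((s - s') * p)) * t ^ (-((s - s') * p)) ≤ |r - t| ^ (-((s - s') * p)) := by
          rw [← Real.mul_rpow hΛ0.le ht.le]
          refine Real.rpow_le_rpow_of_nonpos hrt' hle ?_
          have : 0 ≤ s - s' := by linarith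
          have : 0 ≤ (s - s') * p := by positivity
          linarith
        have e1 : |r - t| ^ (((d - 1 : ℕ) : ℝ) - ((d : ℝ) + s * p))
            = |r - t| ^ (-((s - s') * p)) * |r - t| ^ (-(1 + s' * p)) := by
          rw [← Real.rpow_add hrt']
          congr 1
          push_cast [hd]
          ring
        have e2 : t ^ (α * p - (s - s') * p) = t ^ (α * p) * t ^ (-((s - s') * p)) := by
          rw [← Real.rpow_add ht]; rfl
        rw [e1, e2, abs_sub_comm t r, abs_sub_comm (g t)]
        have hrd : r ^ (d - 1) * (r ^ (d - 1))⁻¹ = 1 := mul_inv_cancel₀ (by positivity)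
        calc _ = c * (Λ ^ (-|α * p|) * t ^ (α * p))
              * (Λ ^ (-((s - s') * p)) * t ^ (-((s - s') * p)))
              * (|g r - g t| ^ p * |r - t| ^ (-(1 + s' * p))) := by ring
          _ ≤ c * r ^ (α * p) * |r - t| ^ (-((s - s') * p))
              * (|g r - g t| ^ p * |r - t| ^ (-(1 + s' * p))) := by gcongr
          _ = (r ^ (d - 1) * (r ^ (d - 1))⁻¹) * (c * r ^ (α * p) * |r - t| ^ (-((s - s') * p))
              * (|g r - g t| ^ p * |r - t| ^ (-(1 + s' * p)))) := by rw [hrd, one_mul]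
          _ = _ := by ring
    _ = ∫⁻ r in Icc (Λ⁻¹ * t) (Λ * t), ∫⁻ ω : sphere (0 : EuclideanSpace ℝ (Fin d)) 1,
          ENNReal.ofReal (r ^ (d - 1) * (|g r - g t| ^ p * r ^ (α * p))) * ENNReal.ofReal
            (‖r • (ω : EuclideanSpace ℝ (Fin d)) - y‖ ^ (-((d : ℝ) + s * p)))
              ∂(volume : Measure (EuclideanSpace ℝ (Fin d))).toSphere := by
        congr 1 with r
        rw [lintegral_const_mul' _ _ ENNReal.ofReal_ne_top]
    _ = ∫⁻ ω : sphere (0 : EuclideanSpace ℝ (Fin d)) 1, ∫⁻ r in Icc (Λ⁻¹ * t) (Λ * t),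
          ENNReal.ofReal (r ^ (d - 1) * (|g r - g t| ^ p * r ^ (α * p))) * ENNReal.ofReal
            (‖r • (ω : EuclideanSpace ℝ (Fin d)) - y‖ ^ (-((d : ℝ) + s * p)))
              ∂volume ∂(volume : Measure (EuclideanSpace ℝ (Fin d))).toSphere := by
        rw [lintegral_lintegral_swap]
        fun_prop
    _ ≤ _ := by
        refine lintegral_mono fun ω => (setLIntegral_mono' measurableSet_Icc fun r hr => ?_).trans
          (lintegral_mono_set hIcc)
        have hr0 : 0 < r := hIcc hr
        have hn : ‖r • (ω : EuclideanSpace ℝ (Fin d))‖ = r := by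
          simp [norm_smul, abs_of_pos hr0]
        rw [hn, chi_eq_one hΛ0 hr, mul_one, ← ENNReal.ofReal_mul (by positivity),
          ← ENNReal.ofReal_mul (by positivity), Real.rpow_neg (norm_nonneg _), div_eq_mul_inv,
          mul_assoc]

lemma exists_radialGagliardo_le (hd : 1 ≤ d) {s s' p α Λ : ℝ} (hs : 0 < s) (hss : s' ≤ s)
    (hp : 0 < p) (hΛ : 1 < Λ) :
    ∃ C : ℝ≥0∞, C ≠ ∞ ∧ ∀ g : ℝ → ℝ, Measurable g →
      radialGagliardo s' p (α * p - (s - s') * p + ((d : ℝ) - 1)) Λ g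
        ≤ C * gagliardo s p α Λ (fun x : EuclideanSpace ℝ (Fin d) => g ‖x‖) ^ p := by
  have : Nonempty (Fin d) := ⟨⟨0, hd⟩⟩
  obtain ⟨c, hc, h⟩ := exists_gagliardoDensity_le_lintegral (α := α) hd hs hss hp hΛ
  set S := (volume : Measure (EuclideanSpace ℝ (Fin d))).toSphere univ with hS
  have hS0 : S ≠ 0 := Measure.measure_univ_ne_zero.2 (Measure.toSphere_ne_zero _)
  have hSt : S ≠ ∞ := measure_ne_top _ _
  have hc0 : ENNReal.ofReal c ≠ 0 := by simpa using hc
  have hcS : ENNReal.ofReal c * S ≠ 0 := mul_ne_zero hc0 hS0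
  have hcSt : ENNReal.ofReal c * S ≠ ∞ := ENNReal.mul_ne_top ENNReal.ofReal_ne_top hSt
  refine ⟨(ENNReal.ofReal c * S)⁻¹, ENNReal.inv_ne_top.2 hcS, fun g hg => ?_⟩
  rw [← ENNReal.div_eq_inv_mul, ENNReal.le_div_iff_mul_le (Or.inl hcS) (Or.inl hcSt), gagliardo,
    ← ENNReal.rpow_mul, one_div_mul_cancel hp.ne', ENNReal.rpow_one]
  have hdens : Measurable fun t : ℝ => gagliardoDensity s' p g (Icc (Λ⁻¹ * t) (Λ * t)) t := by
    have e : (fun t : ℝ => gagliardoDensity s' p g (Icc (Λ⁻¹ * t) (Λ * t)) t) = fun t : ℝ =>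
        ∫⁻ r, {z : ℝ × ℝ | z.2 ∈ Icc (Λ⁻¹ * z.1) (Λ * z.1)}.indicator (fun z : ℝ × ℝ =>
          ENNReal.ofReal (|g z.1 - g z.2| ^ p * |z.1 - z.2| ^ (-(1 + s' * p)))) (t, r) := by
      funext t
      rw [gagliardoDensity, ← lintegral_indicator measurableSet_Icc]
      rfl
    rw [e]
    apply Measurable.lintegral_prod_right'
    refine Measurable.indicator (by fun_prop) ?_
    have h1 : MeasurableSet {z : ℝ × ℝ | Λ⁻¹ * z.1 ≤ z.2} :=
      measurableSet_le (by fun_prop) (by fun_prop)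
    have h2 : MeasurableSet {z : ℝ × ℝ | z.2 ≤ Λ * z.1} :=
      measurableSet_le (by fun_prop) (by fun_prop)
    exact h1.inter h2
  have hpol := lintegral_comp_norm (volume : Measure (EuclideanSpace ℝ (Fin d)))
    (F := fun t : ℝ => ENNReal.ofReal c * (gagliardoDensity s' p g (Icc (Λ⁻¹ * t) (Λ * t)) t
          * ENNReal.ofReal (t ^ (α * p - (s - s') * p)))) (by fun_prop)
  have hdim : Module.finrank ℝ (EuclideanSpace ℝ (Fin d)) = d := by simp
  rw [hdim] at hpol
  calc _ = ∫⁻ y : EuclideanSpace ℝ (Fin d), ENNReal.ofReal c *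
        (gagliardoDensity s' p g (Icc (Λ⁻¹ * ‖y‖) (Λ * ‖y‖)) ‖y‖
          * ENNReal.ofReal (‖y‖ ^ (α * p - (s - s') * p))) := by
        rw [hpol, ← hS, mul_comm (ENNReal.ofReal c), ← mul_assoc, mul_comm _ S, mul_assoc,
          mul_comm _ (ENNReal.ofReal c), radialGagliardo,
          ← lintegral_const_mul' _ _ ENNReal.ofReal_ne_top]
        congr 1
        refine setLIntegral_congr_fun measurableSet_Ioi fun t (ht : 0 < t) => ?_
        have : ((d : ℝ) - 1) = ((d - 1 : ℕ) : ℝ) := by push_cast [hd]; ring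
        rw [radialDensity, Real.rpow_add ht, this, Real.rpow_natCast,
          ENNReal.ofReal_mul (by positivity)]
        ring
    _ ≤ _ := by
        refine lintegral_mono_ae ?_
        have h0 : ∀ᵐ y : EuclideanSpace ℝ (Fin d), y ≠ 0 := by simp [ae_iff]
        filter_upwards [h0] with y hy
        exact h g hg y hy

lemma exists_radialLq_le (hd : 1 ≤ d) {q β : ℝ} (hq : 1 ≤ q) :
    ∃ C : ℝ≥0∞, C ≠ ∞ ∧ ∀ g : ℝ → ℝ, Measurable g →
      radialLq q (β * q + ((d : ℝ) - 1)) g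
        ≤ C * weightedNorm q β (fun x : EuclideanSpace ℝ (Fin d) => g ‖x‖) ^ q := by
  have : Nonempty (Fin d) := ⟨⟨0, hd⟩⟩
  have hq0 : 0 < q := by linarith
  set S := (volume : Measure (EuclideanSpace ℝ (Fin d))).toSphere univ with hS
  have hS0 : S ≠ 0 := Measure.measure_univ_ne_zero.2 (Measure.toSphere_ne_zero _)
  have hSt : S ≠ ∞ := measure_ne_top _ _
  refine ⟨S⁻¹, ENNReal.inv_ne_top.2 hS0, fun g hg => ?_⟩
  rw [← ENNReal.div_eq_inv_mul, ENNReal.le_div_iff_mul_le (Or.inl hS0) (Or.inl hSt), weightedNorm,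
    eLpNorm_eq_lintegral_rpow_enorm_toReal (by simpa using hq0) ENNReal.ofReal_ne_top,
    ENNReal.toReal_ofReal hq0.le, ← ENNReal.rpow_mul, one_div_mul_cancel hq0.ne', ENNReal.rpow_one]
  have hpol := lintegral_comp_norm (volume : Measure (EuclideanSpace ℝ (Fin d)))
    (F := fun t : ℝ => ‖t ^ β * g t‖ₑ ^ q) (by fun_prop)
  have hdim : Module.finrank ℝ (EuclideanSpace ℝ (Fin d)) = d := by simp
  rw [hdim] at hpol
  rw [hpol, mul_comm, radialLq]
  refine le_of_eq ?_
  congr 1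
  refine setLIntegral_congr_fun measurableSet_Ioi fun t (ht : 0 < t) => ?_
  have : ((d : ℝ) - 1) = ((d - 1 : ℕ) : ℝ) := by push_cast [hd]; ring
  rw [Real.rpow_add ht, this, Real.rpow_natCast, ENNReal.ofReal_mul (by positivity), enorm_mul,
    ENNReal.mul_rpow_of_nonneg _ _ hq0.le, Real.enorm_of_nonneg (r := t ^ β) (by positivity),
    ENNReal.ofReal_rpow_of_nonneg (by positivity) hq0.le, ← Real.rpow_mul ht.le]
  ring

lemma ae_eq_zero_of_essSupport {u : EuclideanSpace ℝ (Fin d) → ℝ} :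
    ∀ᵐ x, x ∉ essSupport u → u x = 0 := by
  rw [ae_iff]
  apply measure_null_of_locally_null
  intro x hx
  rw [mem_ofPred_eq, Classical.not_imp, essSupport, mem_ofPred_eq] at hx
  push Not at hx
  obtain ⟨⟨U, hU, h⟩, -⟩ := hx
  refine ⟨_, inter_mem_nhdsWithin _ hU, measure_mono_null ?_ (ae_iff.1 h)⟩
  rintro y ⟨hy, hyU⟩
  rw [mem_ofPred_eq, Classical.not_imp] at hy ⊢
  exact ⟨hyU, hy.2⟩

/-- Both supports are handled at once: only a shell path starting in a null shell and a linear lower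
bound for the logarithm L along it are needed. -/
lemma exists_radial_estimate {d : ℕ} (hd : 1 ≤ d) {s s' p q τ a α β γ μ lam b : ℝ}
    (hs' : 0 < s') (hss : s' ≤ s) (hp : 1 ≤ p) (hq : 1 ≤ q) (hτ : 1 ≤ τ) (ha0 : 0 < a)
    (ha1 : a ≤ 1) (hτμ : τ ≤ μ) (hlam : 1 < lam) (hb : 0 < b)
    (hbal : 1 / τ = a * (1 / p - s') + (1 - a) * (1 / q))
    (hscale : 1 / τ + (α * p - (s - s') * p + ((d : ℝ) - 1)) * (a / p)
      + (β * q + ((d : ℝ) - 1)) * ((1 - a) / q) = 0) (hγ : γ * τ = -(d : ℝ)) :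
    ∃ C : ℝ, 0 < C ∧ ∀ u : EuclideanSpace ℝ (Fin d) → ℝ, AEMeasurable u → IsRadial u →
      ∀ R, 0 < R → ∀ e e' : ℕ → ℤ, IsShellPath e e' →
      (∀ᵐ x, ‖x‖ ∈ Ico (R * lam ^ e 0) (R * lam ^ (e 0 + 1)) → u x = 0) →
      (∀ᵐ x, ‖x‖ ∉ ⋃ n : ℕ, Ico (R * lam ^ e (n + 1)) (R * lam ^ (e (n + 1) + 1)) → u x = 0) →
      ∀ L : ℝ → ℝ, Measurable L →
      (∀ n : ℕ, ∀ r ∈ Ico (R * lam ^ e (n + 1)) (R * lam ^ (e (n + 1) + 1)),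
        b * ((n + 1 : ℕ) : ℝ) ≤ L r) →
      (∫⁻ x, ENNReal.ofReal (‖x‖ ^ (γ * τ) / L ‖x‖ ^ μ * |u x| ^ τ)) ^ (1 / τ)
        ≤ ENNReal.ofReal C * gagliardo s p α (lam ^ 2) u ^ a * weightedNorm q β u ^ (1 - a) := by
  have : Nonempty (Fin d) := ⟨⟨0, hd⟩⟩
  have hp0 : 0 < p := by linarith
  have hq0 : 0 < q := by linarith
  have hτ0 : 0 < τ := by linarith
  have hl0 : 0 < lam := by linarith
  have hap : 0 ≤ a / p := by positivity
  have haq : 0 ≤ (1 - a) / q := div_nonneg (by linarith) hq0.le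
  obtain ⟨C₁, hC₁, h₁⟩ := exists_weighted_estimate (μ := μ) (b := b ^ (-μ)) hs' hp hq hτ ha0 ha1
    hτμ (by positivity) hbal hscale hlam
  obtain ⟨C₂, hC₂, h₂⟩ := exists_radialGagliardo_le (α := α) hd (hs'.trans_le hss) hss hp0
    (one_lt_pow₀ hlam two_ne_zero)
  obtain ⟨C₃, hC₃, h₃⟩ := exists_radialLq_le (β := β) hd hq
  set S := (volume : Measure (EuclideanSpace ℝ (Fin d))).toSphere univ with hS
  set K := (S * C₁) ^ (1 / τ) * (C₂ ^ (a / p) * C₃ ^ ((1 - a) / q)) with hK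
  have hKt : K ≠ ∞ := by
    refine ENNReal.mul_ne_top (ENNReal.rpow_ne_top_of_nonneg (by positivity)
      (ENNReal.mul_ne_top (measure_ne_top _ _) hC₁)) (ENNReal.mul_ne_top ?_ ?_)
    · exact ENNReal.rpow_ne_top_of_nonneg hap hC₂
    · exact ENNReal.rpow_ne_top_of_nonneg haq hC₃
  refine ⟨K.toReal + 1, by positivity, ?_⟩
  rintro u hu ⟨f, hf⟩ R hR e e' he hu0 huZ L hL hLb
  obtain ⟨g, hg, hug⟩ := exists_measurable_profile volume hu hf
  set Z := ⋃ n : ℕ, Ico (R * lam ^ e (n + 1)) (R * lam ^ (e (n + 1) + 1)) with hZ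
  have hZm : MeasurableSet Z := MeasurableSet.iUnion fun n => measurableSet_Ico
  have hgm : MeasurableSet {r | g r = 0} := hg (measurableSet_singleton 0)
  have hg0 : ∀ᵐ r, r ∈ Ico (R * lam ^ e 0) (R * lam ^ (e 0 + 1)) → g r = 0 := by
    have h := ae_of_ae_comp_norm (volume : Measure (EuclideanSpace ℝ (Fin d)))
      (P := fun r => r ∈ Ico (R * lam ^ e 0) (R * lam ^ (e 0 + 1)) → g r = 0)
      (measurableSet_Ico.imp hgm) (by
        filter_upwards [hu0, hug] with x h1 h2 h3
        rw [← h2, h1 h3])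
    filter_upwards [h] with r hr hr'
    exact hr (lt_of_lt_of_le (by positivity) hr'.1) hr'
  have hgZ : ∀ᵐ r, 0 < r → r ∉ Z → g r = 0 :=
    ae_of_ae_comp_norm (volume : Measure (EuclideanSpace ℝ (Fin d)))
      (P := fun r => r ∉ Z → g r = 0) (hZm.compl.imp hgm) (by
        filter_upwards [huZ, hug] with x h1 h2 h3
        rw [← h2, h1 h3])
  set W : ℝ → ℝ≥0∞ := fun r => ENNReal.ofReal (r ^ (d - 1)) *
    ENNReal.ofReal (r ^ (γ * τ) / L r ^ μ) with hW
  have hWm : Measurable W := by fun_prop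
  have hWb : ∀ n : ℕ, ∀ r ∈ Ico (R * lam ^ e (n + 1)) (R * lam ^ (e (n + 1) + 1)),
        W r ≤ ENNReal.ofReal (b ^ (-μ) * ((n + 1 : ℕ) : ℝ) ^ (-μ) * r⁻¹) := by
    intro n r hr
    have hr0 : 0 < r := lt_of_lt_of_le (by positivity) hr.1
    have hn : (0 : ℝ) < ((n + 1 : ℕ) : ℝ) := by positivity
    have hbn : 0 < b * ((n + 1 : ℕ) : ℝ) := by positivity
    have hLr := hLb n r hr
    have hL0 : 0 < L r := hbn.trans_le hLr
    simp only [hW]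
    rw [← ENNReal.ofReal_mul (by positivity), ← Real.mul_rpow hb.le hn.le]
    apply ENNReal.ofReal_le_ofReal
    -- The critical case γτ = -d turns the radial weight into dr/r.
    have e1 : r ^ (d - 1) * r ^ (γ * τ) = r⁻¹ := by
      rw [hγ, ← Real.rpow_natCast, ← Real.rpow_add hr0, ← Real.rpow_neg_one]
      congr 1
      push_cast [hd]
      ring
    rw [div_eq_mul_inv, ← mul_assoc, e1, mul_comm, ← Real.rpow_neg hL0.le]
    exact mul_le_mul_of_nonneg_right (Real.rpow_le_rpow_of_nonpos hbn hLr (by linarith))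
      (by positivity)
  have key := h₁ g hg R hR e e' he hg0 W hWm hWb
  set N := radialGagliardo s' p (α * p - (s - s') * p + ((d : ℝ) - 1)) (lam ^ 2) g
  set Q := radialLq q (β * q + ((d : ℝ) - 1)) g
  have hN : N ≤ C₂ * gagliardo s p α (lam ^ 2) u ^ p := by
    rw [gagliardo_congr_ae s p α (lam ^ 2) hug]; exact h₂ g hg
  have hQ : Q ≤ C₃ * weightedNorm q β u ^ q := by
    have hwn : weightedNorm q β u
        = weightedNorm q β (fun x : EuclideanSpace ℝ (Fin d) => g ‖x‖) :=
      eLpNorm_congr_ae (by filter_upwards [hug] with x hx; rw [hx])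
    rw [hwn]; exact h₃ g hg
  set A := gagliardo s p α (lam ^ 2) u
  set B := weightedNorm q β u
  have hint : ∫⁻ x, ENNReal.ofReal (‖x‖ ^ (γ * τ) / L ‖x‖ ^ μ * |u x| ^ τ)
      = S * ∫⁻ r in Ioi 0, W r * ‖g r‖ₑ ^ τ := by
    have hpol := lintegral_comp_norm (volume : Measure (EuclideanSpace ℝ (Fin d)))
      (F := fun r => ENNReal.ofReal (r ^ (γ * τ) / L r ^ μ) * ‖g r‖ₑ ^ τ) (by fun_prop)
    rw [finrank_euclideanSpace_fin] at hpol
    simp only [hW, mul_assoc, hS]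
    rw [← hpol]
    refine lintegral_congr_ae ?_
    filter_upwards [hug] with x hx
    rw [ENNReal.ofReal_mul' (by positivity), hx, Real.enorm_eq_ofReal_abs,
      ENNReal.ofReal_rpow_of_nonneg (abs_nonneg _) hτ0.le]
  -- Off Z the profile vanishes, so the values of L there, where the logarithm may be negative, are
  -- irrelevant.
  have hle : ∫⁻ r in Ioi 0, W r * ‖g r‖ₑ ^ τ ≤ ∫⁻ r in Z, W r * ‖g r‖ₑ ^ τ := by
    rw [← lintegral_indicator measurableSet_Ioi, ← lintegral_indicator hZm]
    refine lintegral_mono_ae ?_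
    filter_upwards [hgZ] with r hr
    by_cases hr0 : 0 < r
    · by_cases hrZ : r ∈ Z
      · rw [indicator_of_mem hrZ]; exact indicator_le_self _ _ _
      · rw [indicator_of_notMem hrZ, indicator_of_mem (mem_Ioi.2 hr0), hr hr0 hrZ]
        simp [hτ0]
    · rw [indicator_of_notMem (by simpa using hr0)]
      exact zero_le
  have hE : N ^ (a / p) * Q ^ ((1 - a) / q)
      ≤ C₂ ^ (a / p) * C₃ ^ ((1 - a) / q) * (A ^ a * B ^ (1 - a)) := by
    calc _ ≤ (C₂ * A ^ p) ^ (a / p) * (C₃ * B ^ q) ^ ((1 - a) / q) := by gcongr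
      _ = _ := by
        rw [ENNReal.mul_rpow_of_nonneg _ _ hap, ENNReal.mul_rpow_of_nonneg _ _ haq,
          ← ENNReal.rpow_mul, ← ENNReal.rpow_mul, mul_div_cancel₀ _ hp0.ne',
          mul_div_cancel₀ _ hq0.ne']
        ring
  calc _ ≤ (S * (C₁ * (N ^ (a / p) * Q ^ ((1 - a) / q)) ^ τ)) ^ (1 / τ) := by
        rw [hint]
        gcongr
        exact hle.trans key
    _ = (S * C₁) ^ (1 / τ) * (N ^ (a / p) * Q ^ ((1 - a) / q)) := by
        rw [← mul_assoc, ENNReal.mul_rpow_of_nonneg _ _ (by positivity), ← ENNReal.rpow_mul,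
          mul_one_div_cancel hτ0.ne', ENNReal.rpow_one]
    _ ≤ (S * C₁) ^ (1 / τ) * (C₂ ^ (a / p) * C₃ ^ ((1 - a) / q) * (A ^ a * B ^ (1 - a))) := by
        gcongr
    _ = K * (A ^ a * B ^ (1 - a)) := by rw [hK]; ring
    _ ≤ ENNReal.ofReal (K.toReal + 1) * (A ^ a * B ^ (1 - a)) := by
        gcongr
        rw [← ENNReal.ofReal_toReal hKt]
        exact ENNReal.ofReal_le_ofReal (by simp)
    _ = _ := by ring

/-! ### Logarithmic weights, the two shell paths and the conclusion -/

lemma log_lower_bound {lam x : ℝ} (hlam : 1 < lam) (n : ℕ) (hx : 2 * lam ^ n ≤ x) :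
    min (Real.log 2) (Real.log lam) * ((n + 1 : ℕ) : ℝ) ≤ Real.log x := by
  have hl0 : 0 < lam := by linarith
  have h1 := Real.log_le_log (by positivity) hx
  rw [Real.log_mul (by norm_num) (by positivity), Real.log_pow] at h1
  have h2 := min_le_left (Real.log 2) (Real.log lam)
  have h3 := mul_le_mul_of_nonneg_left (min_le_right (Real.log 2) (Real.log lam))
    (n.cast_nonneg (α := ℝ))
  push_cast
  linarith

lemma isShellPath_down : IsShellPath (fun n => -(n : ℤ)) (fun n => -((n : ℤ) + 1)) :=
  ⟨fun m n h => by simpa using h, fun n => Or.inr ⟨by push_cast; ring, by ring⟩⟩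

lemma isShellPath_up : IsShellPath (fun n => (n : ℤ) - 1) (fun n => (n : ℤ) - 1) :=
  ⟨fun m n h => by simpa using h, fun n => Or.inl ⟨rfl, by push_cast; ring⟩⟩

lemma exists_shell_of_pos {lam R r : ℝ} (hlam : 1 < lam) (hR : 0 < R) (hr : 0 < r) :
    ∃ j : ℤ, r ∈ Ico (R * lam ^ j) (R * lam ^ (j + 1)) := by
  obtain ⟨j, h1, h2⟩ := exists_mem_Ico_zpow (div_pos hr hR) hlam
  rw [le_div_iff₀' hR] at h1
  rw [div_lt_iff₀' hR] at h2
  exact ⟨j, h1, h2⟩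

end RadialCKN

end

theorem mainTheorem2 (d : ℕ) (hd : 2 ≤ d) (s p q τ a α β γ μ Λ σ : ℝ)
    (hs0 : 0 < s) (hs1 : s < 1) (hp : 1 < p) (hq : 1 ≤ q) (hτ : 1 ≤ τ)
    (ha0 : 0 < a) (ha1 : a ≤ 1) (hμ : 1 < μ) (hΛ : 1 < Λ) (hτμ : τ ≤ μ)
    (hσ : γ = a * σ + (1 - a) * β)
    (hbalance : 1 / τ + γ / d = a * (1 / p + (α - s) / d) + (1 - a) * (1 / q + β / d))
    (hlow : -((d : ℝ) - 1) * s ≤ α - σ) (hneg : α - σ < 0) :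
    ∃ C : ℝ, 0 < C ∧
      ∀ u : EuclideanSpace ℝ (Fin d) → ℝ,
        MeasureTheory.LocallyIntegrableOn u {0}ᶜ MeasureTheory.volume →
        RadialCKN.IsRadial u →
        ∀ R₁ R₂ : ℝ, 0 < R₁ → 0 < R₂ →
          (1 / τ + γ / d = 0 → RadialCKN.essSupport u ⊆ Metric.ball 0 R₂ →
            (∫⁻ x : EuclideanSpace ℝ (Fin d),
              ENNReal.ofReal (‖x‖ ^ (γ * τ) / Real.log (2 * R₂ / ‖x‖) ^ μ * |u x| ^ τ)) ^ (1 / τ)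
            ≤ ENNReal.ofReal C * RadialCKN.gagliardo s p α Λ u ^ a
                * RadialCKN.weightedNorm q β u ^ (1 - a)) ∧
          (1 / τ + γ / d = 0 → RadialCKN.essSupport u ∩ Metric.ball 0 R₁ = ∅ →
            (∫⁻ x : EuclideanSpace ℝ (Fin d),
              ENNReal.ofReal (‖x‖ ^ (γ * τ) / Real.log (2 * ‖x‖ / R₁) ^ μ * |u x| ^ τ)) ^ (1 / τ)
            ≤ ENNReal.ofReal C * RadialCKN.gagliardo s p α Λ u ^ a
                * RadialCKN.weightedNorm q β u ^ (1 - a)) := by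
  by_cases hzero : 1 / τ + γ / d = 0
  swap
  · exact ⟨1, one_pos, fun u _ _ R₁ R₂ _ _ => ⟨fun h => absurd h hzero, fun h => absurd h hzero⟩⟩
  have hd0 : (0 : ℝ) < d := by exact_mod_cast (by omega : 0 < d)
  have hp0 : 0 < p := by linarith
  have hq0 : 0 < q := by linarith
  have hτ0 : 0 < τ := by linarith
  -- The order forced by the one-dimensional balance relation `hbal`; α < σ gives s' > 0, and the
  -- lower bound on α - σ is equivalent to s' ≤ s.
  set s' := (s + σ - α) / d with hs'
  have hs'd : s' * d = s + σ - α := by rw [hs']; field_simp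
  have hs'0 : 0 < s' := by rw [hs']; apply div_pos _ hd0; linarith
  have hss : s' ≤ s := by rw [hs', div_le_iff₀ hd0]; linarith
  have hγ : γ * τ = -(d : ℝ) := by
    field_simp at hzero
    linarith
  have hbal : 1 / τ = a * (1 / p - s') + (1 - a) * (1 / q) := by
    have h1 : 1 / τ = a * (1 / p + (α - s) / d) + (1 - a) * (1 / q + β / d)
        - (a * σ + (1 - a) * β) / d := by rw [← hσ, ← hbalance]; ring
    rw [h1, hs']
    ring
  have hscale : 1 / τ + (α * p - (s - s') * p + ((d : ℝ) - 1)) * (a / p)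
      + (β * q + ((d : ℝ) - 1)) * ((1 - a) / q) = 0 := by
    have h1 : (α * p - (s - s') * p + ((d : ℝ) - 1)) * (a / p)
        = a * (α - (s - s')) + (d - 1) * (a * (1 / p)) := by field_simp
    have h2 : (β * q + ((d : ℝ) - 1)) * ((1 - a) / q)
        = (1 - a) * β + (d - 1) * ((1 - a) * (1 / q)) := by field_simp
    have h3 : d * (1 / τ) + γ = 0 := by
      have : d * (1 / τ + γ / d) = d * (1 / τ) + γ := by field_simp
      rw [← this, hzero, mul_zero]
    rw [h1, h2]
    linear_combination h3 - hσ - ((d : ℝ) - 1) * hbal + a * hs'd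
  set lam := Real.sqrt Λ with hlamd
  have hlam : 1 < lam := by rw [hlamd, Real.lt_sqrt (by norm_num)]; simpa using hΛ
  have hl0 : 0 < lam := by linarith
  have hlam2 : lam ^ 2 = Λ := Real.sq_sqrt (by linarith)
  have hb : 0 < min (Real.log 2) (Real.log lam) :=
    lt_min (Real.log_pos (by norm_num)) (Real.log_pos hlam)
  obtain ⟨C, hC, h⟩ := RadialCKN.exists_radial_estimate (d := d) (by omega) hs'0 hss hp.le hq hτ ha0
    ha1 hτμ hlam hb hbal hscale hγ
  rw [hlam2] at h
  refine ⟨C, hC, fun u hu hrad R₁ R₂ hR₁ hR₂ => ?_⟩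
  have hum : AEMeasurable u := by
    have : Nonempty (Fin d) := ⟨⟨0, by omega⟩⟩
    have := hu.aestronglyMeasurable.aemeasurable
    rwa [MeasureTheory.restrict_compl_singleton] at this
  have hsupp := RadialCKN.ae_eq_zero_of_essSupport (u := u)
  have hne0 : ∀ᵐ x : EuclideanSpace ℝ (Fin d), x ≠ 0 := by
    have : Nonempty (Fin d) := ⟨⟨0, by omega⟩⟩
    simp [MeasureTheory.ae_iff]
  constructor
  · intro _ hball
    have hout : ∀ᵐ x : EuclideanSpace ℝ (Fin d), R₂ ≤ ‖x‖ → u x = 0 := by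
      filter_upwards [hsupp] with x hx hxR
      refine hx fun hmem => ?_
      have := mem_ball_zero_iff.1 (hball hmem)
      linarith
    -- The path starts at [R₂, lam R₂), where u vanishes, and descends to the origin.
    refine h u hum hrad R₂ hR₂ _ _ RadialCKN.isShellPath_down ?_ ?_
      (fun r => Real.log (2 * R₂ / r)) (by fun_prop) ?_
    · filter_upwards [hout] with x hx hxI
      exact hx (by simpa using hxI.1)
    · filter_upwards [hout, hne0] with x hx hx0 hxZ
      refine hx (not_lt.1 fun hlt => hxZ ?_)
      obtain ⟨j, hj⟩ := RadialCKN.exists_shell_of_pos hlam hR₂ (norm_pos_iff.2 hx0)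
      have hj0 : j < 0 := by
        have h1 : R₂ * lam ^ j < R₂ * 1 := by linarith [hj.1]
        have h2 := lt_of_mul_lt_mul_left h1 hR₂.le
        by_contra hcon
        exact absurd (one_le_zpow₀ hlam.le (not_lt.1 hcon)) (not_le.2 h2)
      obtain ⟨n, hn⟩ : ∃ n : ℕ, j = -((n + 1 : ℕ) : ℤ) := ⟨(-j - 1).toNat, by omega⟩
      exact Set.mem_iUnion.2 ⟨n, by rw [← hn]; exact hj⟩
    · intro n r hr
      have hr0 : 0 < r := lt_of_lt_of_le (by positivity) hr.1
      apply RadialCKN.log_lower_bound hlam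
      have h1 := hr.2
      have e1 : (-((n + 1 : ℕ) : ℤ) + 1) = -(n : ℤ) := by push_cast; ring
      rw [e1, zpow_neg, zpow_natCast, ← div_eq_mul_inv, lt_div_iff₀ (by positivity)] at h1
      rw [le_div_iff₀ hr0]
      nlinarith
  · intro _ hball
    have hout : ∀ᵐ x : EuclideanSpace ℝ (Fin d), ‖x‖ < R₁ → u x = 0 := by
      filter_upwards [hsupp] with x hx hxR
      refine hx fun hmem => ?_
      have : x ∈ RadialCKN.essSupport u ∩ Metric.ball 0 R₁ := ⟨hmem, mem_ball_zero_iff.2 hxR⟩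
      rw [hball] at this
      exact this
    -- The path starts at [R₁/lam, R₁), inside the ball where u vanishes, and ascends; hence the
    -- shift by -1.
    refine h u hum hrad R₁ hR₁ _ _ RadialCKN.isShellPath_up ?_ ?_
      (fun r => Real.log (2 * r / R₁)) (by fun_prop) ?_
    · filter_upwards [hout] with x hx hxI
      exact hx (by simpa using hxI.2)
    · filter_upwards [hout, hne0] with x hx hx0 hxZ
      refine hx (not_le.1 fun hle => hxZ ?_)
      obtain ⟨j, hj⟩ := RadialCKN.exists_shell_of_pos hlam hR₁ (norm_pos_iff.2 hx0)
      have hj0 : 0 ≤ j := by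
        have h1 : R₁ * 1 < R₁ * lam ^ (j + 1) := by linarith [hj.2]
        have h2 := lt_of_mul_lt_mul_left h1 hR₁.le
        by_contra hcon
        exact absurd (zpow_le_one_of_nonpos₀ hlam.le (by omega : j + 1 ≤ 0)) (not_le.2 h2)
      obtain ⟨n, hn⟩ : ∃ n : ℕ, j = ((n + 1 : ℕ) : ℤ) - 1 := ⟨j.toNat, by omega⟩
      exact Set.mem_iUnion.2 ⟨n, by rw [← hn]; exact hj⟩
    · intro n r hr
      apply RadialCKN.log_lower_bound hlam
      have h1 := hr.1
      have e1 : (((n + 1 : ℕ) : ℤ) - 1) = (n : ℤ) := by push_cast; ring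
      rw [e1, zpow_natCast] at h1
      rw [le_div_iff₀ hR₁]
      linarith
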